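/- Let $d\ge 0$ be an integer. For a real $d\times d$ matrix, or a column- or row-vector, $\|M\|$ denotes the sum of the absolute values of the entries of $M$; $U_1,\dots,U_d$ is the canonical basis of column-vectors. For a column-vector $V$ put $\mathcal I(V)=\{i: V(i)\neq0\}$ and for a matrix $M$ put $\mathcal I(M)=\{(i,j): M(i,j)\ne 0\}$. A vector or matrix is nonnegative (positive) if all its entries are. Let $\mathbb N=\{1,2,\dots\}$. (i) Let $(M_n)$ be a sequence of nonnegative $d\times d$ matrices with $M_n\ne0$ for all large $n$, $C$ a nonnegative column-vector and $(L_n)$ a sequence of nonnegative row-vectors such that $\lim_{n\to\infty}\big(\frac{M_n}{\|M_n\|}-CL_n\big)=0$. Then $C\ne0$ and, for every positive column-vector $V$, $\lim_{n\to\infty}\frac{M_nV}{\|M_nV\|}=\frac{C}{\|C\|}$. (ii) Let $(A_n)_{n\in\mathbb N}$ be a sequence of nonnegative $d\times d$ matrices, and put $P_{m,n}=A_{m+1}\cdots A_n$ ($m<n$), $P_{m,m}=I_d$, $P_n=P_{0,n}$. For a nonnegative matrix $A$ let $$\Lambda(A)=\max\{\|AU_j\|/A(i,j): A(i,j)\neq0\},\qquad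 \Lambda(0)=1,$$ $$\lambda(A)=\max\{\|AU_{j'}\|/A(i,j): A(i,j)\ne0=A(i,j')\},$$ with $\lambda(A)=0$ if there is no such triple $(i,j,j')$. Suppose that there are integers $0\le s_0<s_1<s_2<\cdots$ such that: for every $k\in\mathbb N$ the sets $\mathcal I(P_{s_{k-1},s_k}U_j)$, $1\le j\le d$, are totally ordered by inclusion; and $$\sup_{k\in\mathbb N,\ s_k\le n<s_{k+1}}\Lambda(P_{s_{k-1},n})<\infty,\qquad \sup_{k\in\mathbb N,\ s_k\le n<s_{k+1}}\lambda(P_{s_{k-1},n})<1 .$$ Suppose also that $P_n$ is not eventually null. Call *column family* any collection of an integer $\kappa^*\ge1$, nonempty sets $J_1^{(n)},\dots,J_{\kappa^*}^{(n)}\subset\{1,\dots,d\}$, pairwise disjoint for each $n\in\mathbb N$, nonempty sets $I_1\supset\dots\supset I_{\kappa^*}$ in $\{1,\dots,d\}$ (inclusions not necessarily strict) and column-vectors $V_1,\dots,V_{\kappa^*}$ with $\mathcal I(V_h)=I_h$, such that: - $\mathcal I(P_n)=\bigcup_{h=1}^{\kappa^*}I_h\times J_h^{(n)}$ for $n$ large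 enough; - if $j_n\in J_h^{(n)}$ for all $n$, then $P_nU_{j_n}/\|P_nU_{j_n}\|\to V_h$; - if $1\le h<\kappa^*$ and $j_n\in J_h^{(n)}$, $j'_n\in J_{h+1}^{(n)}$ for all $n$, then $\|P_nU_{j'_n}\|/\|P_nU_{j_n}\|\to0$; - there are $\varepsilon_n>0$ with $\varepsilon_n\to0$ such that, for every nonnegative $V$ with $\|V\|=1$ and $P_nV\ne0$ for all $n$, and for every $n$ for which $h=\min\{h:\mathcal I(V)\cap J_h^{(n)}\neq\emptyset\}$ exists, $\big(\min_iV(i)\big)\Big\|\frac{P_nV}{\|P_nV\|}-V_h\Big\|\le\varepsilon_n$; - for every positive $V$, $P_nV/\|P_nV\|\to V_1$ and $\mathcal I(P_nV)=\mathcal I(V_1)$ for $n$ large enough. Then a column family exists and, for every column family, $\lim_{n\to\infty}\big(\frac{P_n}{\|P_n\|}-CL_n\big)=0$ with $$C=\frac{V_1}{\|V_1\|},\qquad L_n(j)=\begin{cases}\|P_nU_j\|/\|P_n\|&\text{if } j\in J_1^{(n)},\\0&\text{otherwise.}\end{cases}$$ -/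

import Mathlib

open Filter Topology

noncomputable section

namespace NonnegProd

variable {d : ℕ}

/-- The norm of a column-vector: the sum of the absolute values of its entries. -/
def vecNorm (v : Fin d → ℝ) : ℝ := ∑ i, |v i|

/-- The norm of a matrix: the sum of the absolute values of its entries. -/
def matNorm (M : Matrix (Fin d) (Fin d) ℝ) : ℝ := ∑ i, ∑ j, |M i j|

/-- The set of indices of the nonnull entries of a column-vector. -/
def supp (v : Fin d → ℝ) : Set (Fin d) := {i | v i ≠ 0}

/-- The set of positions of the nonnull entries of a matrix. -/
def matSupp (M : Matrix (Fin d) (Fin d) ℝ) : Set (Fin d × Fin d) := {p | M p.1 p.2 ≠ 0}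

/-- The partial product `A (m+1) * A (m+2) * ⋯ * A n`, equal to the identity matrix if `n = m`.
Sequences of matrices are indexed by `n ≥ 1`; the value `A 0` is never used. -/
def partialProd (A : ℕ → Matrix (Fin d) (Fin d) ℝ) (m n : ℕ) : Matrix (Fin d) (Fin d) ℝ :=
  ((List.range' (m + 1) (n - m)).map A).prod

/-- The product `A 1 * A 2 * ⋯ * A n`, equal to the identity matrix if `n = 0`. -/
def prodTo (A : ℕ → Matrix (Fin d) (Fin d) ℝ) (n : ℕ) : Matrix (Fin d) (Fin d) ℝ :=
  partialProd A 0 n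

/-- The supports of the columns are totally ordered by inclusion. -/
def CondE (M : Matrix (Fin d) (Fin d) ℝ) : Prop :=
  ∀ j j', supp (M.col j) ⊆ supp (M.col j') ∨ supp (M.col j') ⊆ supp (M.col j)

open Classical in
/-- The largest ratio between the norm of a column and a nonnull entry of the same column;
the value at the null matrix is `1`. -/
def bigLambda (M : Matrix (Fin d) (Fin d) ℝ) : ℝ :=
  if M = 0 then 1
  else sSup {x | ∃ i j, M i j ≠ 0 ∧ x = vecNorm (M.col j) / M i j}

/-- The largest ratio `‖M U_{j'}‖ / M i j` with `M i j ≠ 0 = M i j'`; the value is `0` if there is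
no such triple `(i, j, j')`, in particular at the null matrix. -/
def smallLambda (M : Matrix (Fin d) (Fin d) ℝ) : ℝ :=
  sSup {x | ∃ i j j', M i j ≠ 0 ∧ M i j' = 0 ∧ x = vecNorm (M.col j') / M i j}

/-- Condition `(C)` with respect to the increasing sequence `s 0 < s 1 < ⋯`. -/
structure CondC (A : ℕ → Matrix (Fin d) (Fin d) ℝ) (s : ℕ → ℕ) : Prop where
  strictMono : StrictMono s
  condE : ∀ k, CondE (partialProd A (s k) (s (k + 1)))
  bigLambda_bdd : ∃ b : ℝ, ∀ k n, s (k + 1) ≤ n → n < s (k + 2) →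
    bigLambda (partialProd A (s k) n) ≤ b
  smallLambda_lt_one : ∃ l : ℝ, l < 1 ∧ ∀ k n, s (k + 1) ≤ n → n < s (k + 2) →
    smallLambda (partialProd A (s k) n) ≤ l

/-- The index sets `J h n`, `I h` and the vectors `V h` describe the asymptotic behaviour of the
columns of the products `A 1 * ⋯ * A n`. There are `K + 1` of each, indexed from `0`: the objects
that are usually numbered `1` are those of index `0 : Fin (K + 1)`. -/
structure IsColumnFamily (A : ℕ → Matrix (Fin d) (Fin d) ℝ) (K : ℕ)
    (J : Fin (K + 1) → ℕ → Finset (Fin d)) (I : Fin (K + 1) → Set (Fin d))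
    (V : Fin (K + 1) → Fin d → ℝ) : Prop where
  J_nonempty : ∀ h n, 1 ≤ n → (J h n).Nonempty
  J_disjoint : ∀ n, 1 ≤ n → ∀ h h', h ≠ h' → Disjoint (J h n) (J h' n)
  I_nonempty : ∀ h, (I h).Nonempty
  I_antitone : ∀ h h', h ≤ h' → I h' ⊆ I h
  partition : ∀ᶠ n in atTop, matSupp (prodTo A n) = ⋃ h, I h ×ˢ (J h n : Set (Fin d))
  supp_V : ∀ h, supp (V h) = I h
  /-- the normalized columns with index in `J h n` converge to `V h` -/
  tendsto_column : ∀ h (j : ℕ → Fin d), (∀ n, 1 ≤ n → j n ∈ J h n) →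
    Tendsto (fun n => (vecNorm ((prodTo A n).col (j n)))⁻¹ • (prodTo A n).col (j n))
      atTop (𝓝 (V h))
  /-- the columns with index in `J (h+1) n` are negligible with respect to those with index
  in `J h n` -/
  tendsto_ratio : ∀ (h : Fin K) (j j' : ℕ → Fin d),
    (∀ n, 1 ≤ n → j n ∈ J h.castSucc n) → (∀ n, 1 ≤ n → j' n ∈ J h.succ n) →
    Tendsto (fun n => vecNorm ((prodTo A n).col (j' n)) / vecNorm ((prodTo A n).col (j n)))
      atTop (𝓝 0)
  /-- `‖P_n W / ‖P_n W‖ - V_h‖ ≤ ε_n / min W`, where `h` is the least index such that `J h n`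
  meets the support of `W`; the denominator `min W`, which can be null, is put on the left -/
  uniform : ∃ ε : ℕ → ℝ, (∀ n, 0 < ε n) ∧ Tendsto ε atTop (𝓝 0) ∧
    ∀ W : Fin d → ℝ, (∀ i, 0 ≤ W i) → vecNorm W = 1 →
      (∀ n, 1 ≤ n → (prodTo A n).mulVec W ≠ 0) →
      ∀ n, 1 ≤ n → ∀ h, IsLeast {h | (supp W ∩ (J h n : Set (Fin d))).Nonempty} h →
        (⨅ i, W i) * vecNorm
          ((vecNorm ((prodTo A n).mulVec W))⁻¹ • (prodTo A n).mulVec W - V h) ≤ ε n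
  positive : ∀ W : Fin d → ℝ, (∀ i, 0 < W i) →
    Tendsto (fun n => (vecNorm ((prodTo A n).mulVec W))⁻¹ • (prodTo A n).mulVec W)
      atTop (𝓝 (V 0)) ∧
    ∀ᶠ n in atTop, supp ((prodTo A n).mulVec W) = supp (V 0)

end NonnegProd

end

open NonnegProd

/-!
The first assertion is a computation: if `w = ‖M n‖⁻¹ • M n V` is close to a nonnegative multiple of
`C`, and its norm is bounded below (by the least entry of `V`), then its direction is close to that
of `C` (`vecNorm_mul_normalized_sub_le`).

For the second one, call `IsNested b l M` the conjunction of "the supports of the columns of `M` are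
totally ordered", `Λ M ≤ b` and `λ M ≤ l`. The estimates `Λ (M N) ≤ Λ M + λ M Λ N` and
`λ (M N) ≤ λ M λ N` (`IsNested.mul`) show that, under Condition `(C)`, the function `Λ` is bounded on
all the products starting at some `s i` while `λ` decreases exponentially with the number of blocks
(`CondC.exists_isNested`). This has two consequences.

* A column whose support, in the product started at `s i`, is strictly smaller than the support of
  another column is negligible with respect to it (`exists_vecNorm_col_le`).
* Each block contracts the oscillation of the ratios of two vectors with comparable nonnull entries
  (`IsNested.contraction`), as in Birkhoff's theorem on positive matrices: the block need not be
  positive, because the largest column involved is full and dominates the other ones. Hence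
  columns of `A 1 ⋯ A n` and `A 1 ⋯ A n'` with the same support in the products started at `s i`
  have almost the same direction, with an error exponentially small in `i` (`normalized_col_le`).

It remains to let `i` grow without changing the classes of columns. For fixed `i`, the set of the
supports of the columns of `A (s i + 1) ⋯ A n` decreases with `n`, hence is eventually constant; its
cardinality increases with `i` and is bounded, hence is constant from some `i₀` on, and from then on
two columns with the same support at level `i₀` have the same support at level `i`
(`exists_stable_classes`). The classes of a column family are the sets of columns with a given
support at level `i₀`, ordered by decreasing support (`exists_isColumnFamily`).

Finally, for any column family, the columns of the first class have almost the direction `V 0` and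
the other ones are negligible (`exists_error_sequence`); this gives both the behaviour of positive
vectors and the rank one approximation (`IsColumnFamily.tendsto_rankOne`).
-/

namespace NonnegProd

variable {d : ℕ}

/-! ### The norm of nonnegative vectors -/

/-- The vector `v` divided by its norm (the null vector if `v = 0`). -/
noncomputable abbrev normalized (v : Fin d → ℝ) : Fin d → ℝ := (vecNorm v)⁻¹ • v

lemma vecNorm_nonneg (v : Fin d → ℝ) : 0 ≤ vecNorm v :=
  Finset.sum_nonneg fun _ _ => abs_nonneg _

lemma abs_le_vecNorm (v : Fin d → ℝ) (i : Fin d) : |v i| ≤ vecNorm v :=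
  Finset.single_le_sum (f := fun i => |v i|) (fun _ _ => abs_nonneg _) (Finset.mem_univ i)

lemma le_vecNorm (v : Fin d → ℝ) (i : Fin d) : v i ≤ vecNorm v :=
  (le_abs_self _).trans (abs_le_vecNorm v i)

@[simp] lemma vecNorm_zero : vecNorm (0 : Fin d → ℝ) = 0 := by simp [vecNorm]

lemma vecNorm_eq_zero {v : Fin d → ℝ} : vecNorm v = 0 ↔ v = 0 := by
  refine ⟨fun h => funext fun i => ?_, by rintro rfl; simp⟩
  have := abs_le_vecNorm v i
  rw [h] at this
  exact abs_nonpos_iff.1 this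

lemma vecNorm_pos {v : Fin d → ℝ} (h : v ≠ 0) : 0 < vecNorm v :=
  (vecNorm_nonneg v).lt_of_ne' fun h' => h (vecNorm_eq_zero.1 h')

lemma vecNorm_smul (c : ℝ) (v : Fin d → ℝ) : vecNorm (c • v) = |c| * vecNorm v := by
  simp [vecNorm, abs_mul, Finset.mul_sum]

lemma vecNorm_add_le (v w : Fin d → ℝ) : vecNorm (v + w) ≤ vecNorm v + vecNorm w := by
  simp only [vecNorm, ← Finset.sum_add_distrib]
  exact Finset.sum_le_sum fun i _ => abs_add_le _ _

lemma vecNorm_neg (v : Fin d → ℝ) : vecNorm (-v) = vecNorm v := by simp [vecNorm]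

lemma vecNorm_sub_le (v w : Fin d → ℝ) : vecNorm (v - w) ≤ vecNorm v + vecNorm w := by
  simpa [sub_eq_add_neg, vecNorm_neg] using vecNorm_add_le v (-w)

lemma vecNorm_sum_le {ι : Type*} (s : Finset ι) (f : ι → Fin d → ℝ) :
    vecNorm (∑ k ∈ s, f k) ≤ ∑ k ∈ s, vecNorm (f k) := by
  classical
  induction s using Finset.induction_on with
  | empty => simp
  | insert a s ha ih =>
    rw [Finset.sum_insert ha, Finset.sum_insert ha]
    exact (vecNorm_add_le _ _).trans (by gcongr)

lemma vecNorm_of_nonneg {v : Fin d → ℝ} (h : ∀ i, 0 ≤ v i) : vecNorm v = ∑ i, v i :=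
  Finset.sum_congr rfl fun i _ => abs_of_nonneg (h i)

lemma continuous_vecNorm : Continuous (vecNorm : (Fin d → ℝ) → ℝ) := by
  unfold vecNorm
  fun_prop

lemma vecNorm_normalized {v : Fin d → ℝ} (h : v ≠ 0) : vecNorm (normalized v) = 1 := by
  have := vecNorm_pos h
  rw [normalized, vecNorm_smul, abs_of_pos (inv_pos.2 this), inv_mul_cancel₀ this.ne']

lemma vecNorm_normalized_le (v : Fin d → ℝ) : vecNorm (normalized v) ≤ 1 := by
  by_cases h : v = 0
  · simp [h]
  · exact (vecNorm_normalized h).le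

lemma vecNorm_smul_normalized (v : Fin d → ℝ) : vecNorm v • normalized v = v := by
  by_cases h : v = 0
  · simp [h]
  · rw [normalized, smul_smul, mul_inv_cancel₀ (vecNorm_pos h).ne', one_smul]

lemma tendsto_of_vecNorm_sub {ι : Type*} {l : Filter ι} {f : ι → Fin d → ℝ} {v : Fin d → ℝ}
    (h : Tendsto (fun n => vecNorm (f n - v)) l (𝓝 0)) : Tendsto f l (𝓝 v) := by
  refine tendsto_pi_nhds.2 fun i => tendsto_iff_dist_tendsto_zero.2 ?_
  refine squeeze_zero (fun _ => dist_nonneg) (fun n => ?_) h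
  rw [Real.dist_eq]
  exact abs_le_vecNorm (f n - v) i

lemma tendsto_vecNorm_sub {ι : Type*} {l : Filter ι} {f : ι → Fin d → ℝ} {v : Fin d → ℝ}
    (h : Tendsto f l (𝓝 v)) : Tendsto (fun n => vecNorm (f n - v)) l (𝓝 0) := by
  have := (continuous_vecNorm.tendsto _).comp (h.sub_const v)
  simpa [Function.comp_def] using this

/-- If `m v ≤ u ≤ M v` entrywise and `M / m ≤ r`, then the entries of `u` and `v`, once
normalized, have ratios between `1 / r` and `r`. -/
lemma normalized_le_of_between {u v : Fin d → ℝ} {m M r : ℝ} (hu : ∀ i, 0 ≤ u i)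
    (hv : ∀ i, 0 ≤ v i) (hu0 : u ≠ 0) (hv0 : v ≠ 0) (hm : 0 < m) (hMr : M ≤ r * m)
    (h1 : ∀ i, m * v i ≤ u i) (h2 : ∀ i, u i ≤ M * v i) (i : Fin d) :
    normalized u i ≤ r * normalized v i ∧ normalized v i ≤ r * normalized u i := by
  have pu := vecNorm_pos hu0
  have pv := vecNorm_pos hv0
  have e1 : m * vecNorm v ≤ vecNorm u := by
    rw [vecNorm_of_nonneg hu, vecNorm_of_nonneg hv, Finset.mul_sum]
    exact Finset.sum_le_sum fun i _ => h1 i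
  have e2 : vecNorm u ≤ M * vecNorm v := by
    rw [vecNorm_of_nonneg hu, vecNorm_of_nonneg hv, Finset.mul_sum]
    exact Finset.sum_le_sum fun i _ => h2 i
  have e3 : m ≤ M := le_of_mul_le_mul_right (e1.trans e2) pv
  have hr : 0 ≤ r := by
    by_contra h
    nlinarith
  simp only [normalized, Pi.smul_apply, smul_eq_mul]
  rw [inv_mul_eq_div, inv_mul_eq_div, mul_div_assoc', mul_div_assoc', div_le_div_iff₀ pu pv,
    div_le_div_iff₀ pv pu]
  constructor
  · calc u i * vecNorm v ≤ (M * v i) * vecNorm v := by gcongr; exact h2 i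
      _ ≤ (r * m * v i) * vecNorm v := by gcongr; exact hv i
      _ = r * v i * (m * vecNorm v) := by ring
      _ ≤ r * v i * vecNorm u := by
        gcongr
        exact mul_nonneg hr (hv i)
  · calc v i * vecNorm u ≤ v i * (M * vecNorm v) := by gcongr; exact hv i
      _ ≤ v i * (r * m * vecNorm v) := by gcongr; exact hv i
      _ = r * (m * v i) * vecNorm v := by ring
      _ ≤ r * u i * vecNorm v := by gcongr; exact h1 i

lemma vecNorm_normalized_sub_le {u v : Fin d → ℝ} {r : ℝ} (hr : 1 ≤ r)
    (hu : ∀ i, 0 ≤ u i) (hv : ∀ i, 0 ≤ v i)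
    (h : ∀ i, normalized u i ≤ r * normalized v i ∧ normalized v i ≤ r * normalized u i) :
    vecNorm (normalized u - normalized v) ≤ 2 * (r - 1) := by
  have nu : ∀ i, 0 ≤ normalized u i := fun i => mul_nonneg (inv_nonneg.2 (vecNorm_nonneg u)) (hu i)
  have nv : ∀ i, 0 ≤ normalized v i := fun i => mul_nonneg (inv_nonneg.2 (vecNorm_nonneg v)) (hv i)
  calc vecNorm (normalized u - normalized v)
      ≤ ∑ i, (r - 1) * (normalized u i + normalized v i) := by
        refine Finset.sum_le_sum fun i _ => ?_
        have h1 := mul_nonneg (sub_nonneg.2 hr) (nu i)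
        have h2 := mul_nonneg (sub_nonneg.2 hr) (nv i)
        have := h i
        rw [Pi.sub_apply, abs_le]
        constructor <;> nlinarith
    _ = (r - 1) * (vecNorm (normalized u) + vecNorm (normalized v)) := by
        rw [← Finset.mul_sum, Finset.sum_add_distrib, vecNorm_of_nonneg nu, vecNorm_of_nonneg nv]
    _ ≤ (r - 1) * (1 + 1) := by
        have := vecNorm_normalized_le u
        have := vecNorm_normalized_le v
        have := sub_nonneg.2 hr
        gcongr
    _ = 2 * (r - 1) := by ring

/-! ### Nonnegative matrices acting on nonnegative vectors -/

lemma col_mul (M N : Matrix (Fin d) (Fin d) ℝ) (j : Fin d) :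
    (M * N).col j = M.mulVec (N.col j) := rfl

lemma mulVec_apply_sum (M : Matrix (Fin d) (Fin d) ℝ) (v : Fin d → ℝ) (i : Fin d) :
    M.mulVec v i = ∑ k, M i k * v k := rfl

lemma mulVec_nonneg {M : Matrix (Fin d) (Fin d) ℝ} (hM : ∀ i j, 0 ≤ M i j) {v : Fin d → ℝ}
    (hv : ∀ i, 0 ≤ v i) (i : Fin d) : 0 ≤ M.mulVec v i := by
  rw [mulVec_apply_sum]
  exact Finset.sum_nonneg fun k _ => mul_nonneg (hM i k) (hv k)

lemma mulVec_mono {M : Matrix (Fin d) (Fin d) ℝ} (hM : ∀ i j, 0 ≤ M i j) {v w : Fin d → ℝ}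
    (h : ∀ i, v i ≤ w i) (i : Fin d) : M.mulVec v i ≤ M.mulVec w i := by
  rw [mulVec_apply_sum, mulVec_apply_sum]
  exact Finset.sum_le_sum fun k _ => mul_le_mul_of_nonneg_left (h k) (hM i k)

lemma mul_le_mulVec {M : Matrix (Fin d) (Fin d) ℝ} (hM : ∀ i j, 0 ≤ M i j) {v : Fin d → ℝ}
    (hv : ∀ i, 0 ≤ v i) (i k : Fin d) : M i k * v k ≤ M.mulVec v i :=
  Finset.single_le_sum (f := fun k => M i k * v k) (fun k _ => mul_nonneg (hM i k) (hv k))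
    (Finset.mem_univ k)

lemma vecNorm_mulVec {M : Matrix (Fin d) (Fin d) ℝ} (hM : ∀ i j, 0 ≤ M i j) {v : Fin d → ℝ}
    (hv : ∀ i, 0 ≤ v i) : vecNorm (M.mulVec v) = ∑ k, vecNorm (M.col k) * v k := by
  rw [vecNorm_of_nonneg (mulVec_nonneg hM hv)]
  simp only [mulVec_apply_sum]
  rw [Finset.sum_comm]
  refine Finset.sum_congr rfl fun k _ => ?_
  rw [vecNorm_of_nonneg (v := M.col k) fun i => hM i k, Finset.sum_mul]
  rfl

lemma mulVec_ne_zero_iff {M : Matrix (Fin d) (Fin d) ℝ} (hM : ∀ i j, 0 ≤ M i j) {v : Fin d → ℝ}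
    (hv : ∀ i, 0 ≤ v i) (i : Fin d) : M.mulVec v i ≠ 0 ↔ ∃ k, v k ≠ 0 ∧ M i k ≠ 0 := by
  rw [mulVec_apply_sum, Ne, Finset.sum_eq_zero_iff_of_nonneg fun k _ => mul_nonneg (hM i k) (hv k)]
  simp only [Finset.mem_univ, true_imp_iff, mul_eq_zero, not_forall, not_or]
  exact ⟨fun ⟨k, h⟩ => ⟨k, h.2, h.1⟩, fun ⟨k, h⟩ => ⟨k, h.2, h.1⟩⟩

/-- The support of `M v` for nonnegative `M` and `v`, as a function of the support of `v`. -/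
def suppMap (M : Matrix (Fin d) (Fin d) ℝ) (T : Set (Fin d)) : Set (Fin d) :=
  {i | ∃ k ∈ T, M i k ≠ 0}

lemma supp_mulVec {M : Matrix (Fin d) (Fin d) ℝ} (hM : ∀ i j, 0 ≤ M i j) {v : Fin d → ℝ}
    (hv : ∀ i, 0 ≤ v i) : supp (M.mulVec v) = suppMap M (supp v) :=
  Set.ext fun i => mulVec_ne_zero_iff hM hv i

lemma suppMap_mono (M : Matrix (Fin d) (Fin d) ℝ) {T T' : Set (Fin d)} (h : T ⊆ T') :
    suppMap M T ⊆ suppMap M T' := fun _ ⟨k, hk, h'⟩ => ⟨k, h hk, h'⟩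

lemma supp_nonempty {v : Fin d → ℝ} : (supp v).Nonempty ↔ v ≠ 0 := Function.ne_iff.symm

lemma supp_mulVec_nonempty {M : Matrix (Fin d) (Fin d) ℝ} {v : Fin d → ℝ}
    (h : M.mulVec v ≠ 0) : (supp v).Nonempty := by
  rw [supp_nonempty]
  rintro rfl
  simp at h

/-! ### Matrices with nested columns -/

/-- Nonnegative matrices with column supports totally ordered by inclusion, such that
`Λ M ≤ b` and `λ M ≤ l`, these two bounds being expressed entry by entry. -/
structure IsNested (b l : ℝ) (M : Matrix (Fin d) (Fin d) ℝ) : Prop where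
  nonneg : ∀ i j, 0 ≤ M i j
  condE : CondE M
  norm_le : ∀ i j, M i j ≠ 0 → vecNorm (M.col j) ≤ b * M i j
  norm_le' : ∀ i j j', M i j ≠ 0 → M i j' = 0 → vecNorm (M.col j') ≤ l * M i j

lemma IsNested.mono {b b' l l' : ℝ} {M : Matrix (Fin d) (Fin d) ℝ} (h : IsNested b l M)
    (hb : b ≤ b') (hl : l ≤ l') : IsNested b' l' M where
  nonneg := h.nonneg
  condE := h.condE
  norm_le i j hij := (h.norm_le i j hij).trans (mul_le_mul_of_nonneg_right hb (h.nonneg i j))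
  norm_le' i j j' hij hij' :=
    (h.norm_le' i j j' hij hij').trans (mul_le_mul_of_nonneg_right hl (h.nonneg i j))

/-- The image of a nonempty set under `suppMap M` is the support of a single column of `M`. -/
lemma CondE.exists_suppMap_eq {M : Matrix (Fin d) (Fin d) ℝ} (hM : CondE M) {T : Set (Fin d)}
    (hT : T.Nonempty) : ∃ k ∈ T, suppMap M T = supp (M.col k) := by
  obtain ⟨k, hk, hmax⟩ := T.toFinite.exists_maximalFor (fun k => supp (M.col k)) T hT
  refine ⟨k, hk, Set.Subset.antisymm ?_ fun i hi => ⟨k, hk, hi⟩⟩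
  rintro i ⟨k', hk', hi⟩
  rcases hM k' k with h | h
  · exact h hi
  · exact hmax hk' h hi

lemma CondE.mul {M N : Matrix (Fin d) (Fin d) ℝ} (hM : ∀ i j, 0 ≤ M i j) (hN : ∀ i j, 0 ≤ N i j)
    (h : CondE M) : CondE (M * N) := by
  intro j j'
  rw [col_mul, col_mul, supp_mulVec hM (v := N.col j) fun i => hN i j,
    supp_mulVec hM (v := N.col j') fun i => hN i j']
  rcases (supp (N.col j)).eq_empty_or_nonempty with e | e
  · left; simp [e, suppMap]
  rcases (supp (N.col j')).eq_empty_or_nonempty with e' | e'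
  · right; simp [e', suppMap]
  obtain ⟨k, -, hk⟩ := h.exists_suppMap_eq e
  obtain ⟨k', -, hk'⟩ := h.exists_suppMap_eq e'
  rw [hk, hk']
  exact h k k'

/-- The estimates `Λ (M N) ≤ Λ M + λ M Λ N` and `λ (M N) ≤ λ M λ N`. In both of them, an entry
`(i, j)` of `M N` is compared with one of its nonnull terms `M i k * N k j`. -/
lemma IsNested.mul {b₁ b₂ l₁ l₂ : ℝ} {M N : Matrix (Fin d) (Fin d) ℝ} (hM : IsNested b₁ l₁ M)
    (hN : IsNested b₂ l₂ N) (hl₁ : 0 ≤ l₁) (hl₂ : 0 ≤ l₂) :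
    IsNested (b₁ + l₁ * b₂) (l₁ * l₂) (M * N) where
  nonneg i j := mulVec_nonneg hM.nonneg (fun k => hN.nonneg k j) i
  condE := hM.condE.mul hM.nonneg hN.nonneg
  norm_le i j hij := by
    have hNj : ∀ k, 0 ≤ N.col j k := fun k => hN.nonneg k j
    obtain ⟨k, hk, hik⟩ := (mulVec_ne_zero_iff hM.nonneg hNj i).1 hij
    have hle := mul_le_mulVec hM.nonneg hNj i k
    have h0 : ∀ k', 0 ≤ M i k * N k' j := fun k' => mul_nonneg (hM.nonneg i k) (hN.nonneg k' j)
    rw [col_mul, vecNorm_mulVec hM.nonneg hNj]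
    calc ∑ k', vecNorm (M.col k') * N.col j k'
        ≤ ∑ k', (b₁ * (M i k' * N k' j) + l₁ * (M i k * N k' j)) := by
          refine Finset.sum_le_sum fun k' _ => ?_
          rw [Matrix.col_apply]
          by_cases h : M i k' = 0
          · have := mul_le_mul_of_nonneg_right (hM.norm_le' i k k' hik h) (hN.nonneg k' j)
            rw [h]
            linarith
          · have := mul_le_mul_of_nonneg_right (hM.norm_le i k' h) (hN.nonneg k' j)
            have := mul_nonneg hl₁ (h0 k')
            linarith
      _ = b₁ * (M * N) i j + l₁ * M i k * vecNorm (N.col j) := by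
          rw [Finset.sum_add_distrib, ← Finset.mul_sum, ← Finset.mul_sum, ← Finset.mul_sum,
            vecNorm_of_nonneg hNj, Matrix.mul_apply, mul_assoc]
          rfl
      _ ≤ b₁ * (M * N) i j + l₁ * M i k * (b₂ * N k j) := by
          have := hM.nonneg i k
          gcongr
          exact hN.norm_le k j hk
      _ = b₁ * (M * N) i j + (l₁ * b₂) * (M i k * N k j) := by ring
      _ ≤ b₁ * (M * N) i j + (l₁ * b₂) * (M * N) i j := by
          have hb₂ : 0 ≤ b₂ := by
            have h1 := hN.norm_le k j hk
            have h2 : 0 < N k j := (hN.nonneg k j).lt_of_ne' hk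
            exact nonneg_of_mul_nonneg_left ((vecNorm_nonneg _).trans h1) h2
          gcongr
          exact hle
      _ = (b₁ + l₁ * b₂) * (M * N) i j := by ring
  norm_le' i j j' hij hij' := by
    have hNj : ∀ j k, 0 ≤ N.col j k := fun j k => hN.nonneg k j
    obtain ⟨k, hk, hik⟩ := (mulVec_ne_zero_iff hM.nonneg (hNj j) i).1 hij
    have hle := mul_le_mulVec hM.nonneg (hNj j) i k
    have hz : ∀ k', N k' j' ≠ 0 → M i k' = 0 := fun k' hk' => by
      by_contra h
      exact (mulVec_ne_zero_iff hM.nonneg (hNj j') i).2 ⟨k', hk', h⟩ hij'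
    have hkj' : N k j' = 0 := by
      by_contra h
      exact hik (hz k h)
    rw [col_mul, vecNorm_mulVec hM.nonneg (hNj j')]
    calc ∑ k', vecNorm (M.col k') * N.col j' k'
        ≤ ∑ k', l₁ * M i k * N k' j' := by
          refine Finset.sum_le_sum fun k' _ => ?_
          rw [Matrix.col_apply]
          by_cases h : N k' j' = 0
          · simp [h]
          · exact mul_le_mul_of_nonneg_right (hM.norm_le' i k k' hik (hz k' h)) (hN.nonneg k' j')
      _ = l₁ * M i k * vecNorm (N.col j') := by
          rw [← Finset.mul_sum, vecNorm_of_nonneg (hNj j')]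
          rfl
      _ ≤ l₁ * M i k * (l₂ * N k j) := by
          have := hM.nonneg i k
          gcongr
          exact hN.norm_le' k j j' hk hkj'
      _ = (l₁ * l₂) * (M i k * N k j) := by ring
      _ ≤ (l₁ * l₂) * (M * N) i j := by
          gcongr
          exact hle

/-- A nested matrix contracts the oscillation of the entrywise ratio of two vectors, when the
nonnull entries of one of them are comparable. -/
lemma IsNested.contraction {b l m M : ℝ} {B : Matrix (Fin d) (Fin d) ℝ} (hB : IsNested b l B)
    (hb : 1 ≤ b) (hl : l < 1) {x y : Fin d → ℝ} (hy : ∀ i, 0 ≤ y i)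
    (hyb : ∀ i, y i ≠ 0 → vecNorm y ≤ b * y i) (hmM : m ≤ M)
    (h1 : ∀ i, m * y i ≤ x i) (h2 : ∀ i, x i ≤ M * y i) :
    ∃ m' M', m ≤ m' ∧ m' ≤ M' ∧ M' ≤ M ∧ M' - m' ≤ (1 - 1 / (2 * b ^ 2)) * (M - m) ∧
      (∀ i, m' * B.mulVec y i ≤ B.mulVec x i) ∧ ∀ i, B.mulVec x i ≤ M' * B.mulVec y i := by
  by_cases hy0 : y = 0
  · have hx0 : x = 0 := by
      ext i
      have := h1 i
      have := h2 i
      simp only [hy0, Pi.zero_apply, mul_zero] at *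
      linarith
    have hc : 0 ≤ 1 - 1 / (2 * b ^ 2) := by
      rw [sub_nonneg, div_le_one (by positivity)]
      nlinarith
    refine ⟨m, m, le_rfl, le_rfl, hmM, ?_, ?_, ?_⟩
    · rw [sub_self]
      exact mul_nonneg hc (sub_nonneg.2 hmM)
    · simp [hy0, hx0]
    · simp [hy0, hx0]
  obtain ⟨k, hk, hmax⟩ := (supp y).toFinite.exists_maximalFor (fun k => vecNorm (B.col k)) (supp y)
    (supp_nonempty.2 hy0)
  have hmax' : ∀ k', y k' ≠ 0 → vecNorm (B.col k') ≤ vecNorm (B.col k) := fun k' hk' =>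
    (le_total _ _).elim id fun h => hmax hk' h
  set c : ℝ := 1 / (2 * b ^ 2) with hc
  have hc0 : 0 ≤ c := by positivity
  have hc1 : c ≤ 1 := by
    rw [hc, div_le_one (by positivity)]
    nlinarith
  have hcb : c * b ^ 2 = 1 / 2 := by
    rw [hc]
    field_simp
  -- By the choice of `k`, the term of index `k` in `(B y) i` is a fixed proportion of it.
  have key : ∀ i, c * B.mulVec y i ≤ B i k * y k / 2 := by
    intro i
    by_cases hi : B.mulVec y i = 0
    · rw [hi, mul_zero]
      have := mul_nonneg (hB.nonneg i k) (hy k)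
      positivity
    obtain ⟨k', hk', hik'⟩ := (mulVec_ne_zero_iff hB.nonneg hy i).1 hi
    have hik : B i k ≠ 0 := by
      intro h
      have h1 := hB.norm_le' i k' k hik' h
      have h2 := le_vecNorm (B.col k') i
      have h3 := hmax' k' hk'
      have h4 : 0 < B i k' := (hB.nonneg i k').lt_of_ne' hik'
      rw [Matrix.col_apply] at h2
      nlinarith
    have e : B.mulVec y i ≤ b ^ 2 * (B i k * y k) := by
      calc B.mulVec y i ≤ ∑ k', vecNorm (B.col k) * y k' := by
            rw [mulVec_apply_sum]
            refine Finset.sum_le_sum fun k' _ => ?_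
            by_cases h : y k' = 0
            · simp [h]
            · exact mul_le_mul_of_nonneg_right ((le_vecNorm (B.col k') i).trans (hmax' k' h)) (hy k')
        _ = vecNorm (B.col k) * vecNorm y := by rw [← Finset.mul_sum, vecNorm_of_nonneg hy]
        _ ≤ (b * B i k) * (b * y k) :=
            mul_le_mul (hB.norm_le i k hik) (hyb k hk) (vecNorm_nonneg _)
              (mul_nonneg (by linarith) (hB.nonneg i k))
        _ = b ^ 2 * (B i k * y k) := by ring
    calc c * B.mulVec y i ≤ c * (b ^ 2 * (B i k * y k)) := by gcongr
      _ = (c * b ^ 2) * (B i k * y k) := by ring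
      _ = B i k * y k / 2 := by rw [hcb]; ring
  have lin : ∀ (p q : ℝ) (i : Fin d),
      B.mulVec (fun k => p * x k + q * y k) i = p * B.mulVec x i + q * B.mulVec y i := by
    intro p q i
    simp only [mulVec_apply_sum, Finset.mul_sum, ← Finset.sum_add_distrib]
    exact Finset.sum_congr rfl fun k _ => by ring
  have hMm := sub_nonneg.2 hmM
  have g1 := mulVec_mono hB.nonneg (v := fun k => m * y k) h1
  have g2 := mulVec_mono hB.nonneg (w := fun k => M * y k) h2
  have lin1 : ∀ (q : ℝ) (i : Fin d), B.mulVec (fun k => q * y k) i = q * B.mulVec y i := by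
    intro q i
    simpa using lin 0 q i
  simp only [lin1] at g1 g2
  -- The ratio `x k / y k` is in the upper or in the lower half of `[m, M]`: the lower bound, or the
  -- upper bound, is improved accordingly.
  rcases le_total ((M - m) * y k / 2) (x k - m * y k) with h | h
  · refine ⟨m + c * (M - m), M, ?_, ?_, le_rfl, ?_, fun i => ?_, g2⟩
    · linarith [mul_nonneg hc0 hMm]
    · nlinarith
    · linarith
    · have a1 := mul_le_mulVec hB.nonneg (v := fun k => 1 * x k + -m * y k)
        (fun k => by linarith [h1 k]) i k
      rw [lin] at a1
      have a2 := mul_le_mul_of_nonneg_left (key i) hMm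
      have a3 := mul_le_mul_of_nonneg_left h (hB.nonneg i k)
      linarith
  · refine ⟨m, M - c * (M - m), le_rfl, ?_, ?_, ?_, g1, fun i => ?_⟩
    · nlinarith
    · linarith [mul_nonneg hc0 hMm]
    · linarith
    · have a1 := mul_le_mulVec hB.nonneg (v := fun k => (-1) * x k + M * y k)
        (fun k => by linarith [h2 k]) i k
      rw [lin] at a1
      have a2 := mul_le_mul_of_nonneg_left (key i) hMm
      have a3 := mul_le_mul_of_nonneg_left h (hB.nonneg i k)
      linarith

/-! ### Partial products -/

lemma partialProd_self (A : ℕ → Matrix (Fin d) (Fin d) ℝ) (m : ℕ) : partialProd A m m = 1 := by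
  simp [partialProd]

lemma partialProd_mul (A : ℕ → Matrix (Fin d) (Fin d) ℝ) {m n p : ℕ} (h : m ≤ n) (h' : n ≤ p) :
    partialProd A m p = partialProd A m n * partialProd A n p := by
  obtain ⟨a, rfl⟩ := Nat.exists_eq_add_of_le h
  obtain ⟨c, rfl⟩ := Nat.exists_eq_add_of_le h'
  have e1 : m + a + c - m = a + c := by omega
  have e2 : m + a - m = a := by omega
  have e3 : m + a + c - (m + a) = c := by omega
  rw [partialProd, partialProd, partialProd, ← List.prod_append, ← List.map_append, e1, e2, e3,
    ← List.range'_append_1, show m + 1 + a = m + a + 1 by omega]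

lemma partialProd_succ (A : ℕ → Matrix (Fin d) (Fin d) ℝ) {m n : ℕ} (h : m ≤ n) :
    partialProd A m (n + 1) = partialProd A m n * A (n + 1) := by
  rw [partialProd_mul A h n.le_succ]
  simp [partialProd]

lemma prodTo_eq_mul (A : ℕ → Matrix (Fin d) (Fin d) ℝ) {m n : ℕ} (h : m ≤ n) :
    prodTo A n = prodTo A m * partialProd A m n :=
  partialProd_mul A m.zero_le h

lemma partialProd_nonneg {A : ℕ → Matrix (Fin d) (Fin d) ℝ}
    (hA : ∀ n, 1 ≤ n → ∀ i j, 0 ≤ A n i j) (m n : ℕ) (i j : Fin d) :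
    0 ≤ partialProd A m n i j := by
  have h1 : ∀ i j, 0 ≤ (1 : Matrix (Fin d) (Fin d) ℝ) i j := fun i j => by
    rw [Matrix.one_apply]
    split_ifs <;> norm_num
  rcases le_total m n with h | h
  · induction n, h using Nat.le_induction generalizing i j with
    | base => rw [partialProd_self]; exact h1 i j
    | succ n hn ih =>
      rw [partialProd_succ A hn]
      exact mulVec_nonneg (v := fun k => A (n + 1) k j) ih (fun k => hA _ (by omega) k j) i
  · rw [partialProd, Nat.sub_eq_zero_of_le h]
    exact h1 i j

lemma col_prodTo_nonneg {A : ℕ → Matrix (Fin d) (Fin d) ℝ}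
    (hA : ∀ n, 1 ≤ n → ∀ i j, 0 ≤ A n i j) (n : ℕ) (j i : Fin d) : 0 ≤ (prodTo A n).col j i :=
  partialProd_nonneg hA 0 n i j

/-- Once a product is null, all the following ones are. -/
lemma prodTo_ne_zero {A : ℕ → Matrix (Fin d) (Fin d) ℝ} (h : ¬ ∀ᶠ n in atTop, prodTo A n = 0)
    (n : ℕ) : prodTo A n ≠ 0 := fun h0 => h <| by
  filter_upwards [eventually_ge_atTop n] with p hp
  rw [prodTo_eq_mul A hp, h0, zero_mul]

lemma exists_col_ne_zero {M : Matrix (Fin d) (Fin d) ℝ} (h : M ≠ 0) : ∃ j, M.col j ≠ 0 := by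
  by_contra! hM
  exact h (Matrix.ext fun i j => congrFun (hM j) i)

lemma CondC.exists_isNested_block {A : ℕ → Matrix (Fin d) (Fin d) ℝ} {s : ℕ → ℕ}
    (hA : ∀ n, 1 ≤ n → ∀ i j, 0 ≤ A n i j) (hC : CondC A s) :
    ∃ b l : ℝ, 1 ≤ b ∧ 0 ≤ l ∧ l < 1 ∧ ∀ k n, s (k + 1) ≤ n → n < s (k + 2) →
      IsNested b l (partialProd A (s k) n) := by
  obtain ⟨b, hb⟩ := hC.bigLambda_bdd
  obtain ⟨l, hl, hl'⟩ := hC.smallLambda_lt_one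
  refine ⟨max b 1, max l 0, le_max_right _ _, le_max_right _ _, max_lt hl one_pos,
    fun k n h1 h2 => ?_⟩
  have nn := partialProd_nonneg hA (s k) n
  refine IsNested.mono (b := b) (l := l) ⟨nn, ?_, fun i j hij => ?_, fun i j j' hij hij' => ?_⟩
    (le_max_left _ _) (le_max_left _ _)
  · rw [partialProd_mul A (hC.strictMono k.lt_succ_self).le h1]
    exact (hC.condE k).mul (partialProd_nonneg hA _ _) (partialProd_nonneg hA _ _)
  · have hne : partialProd A (s k) n ≠ 0 := by
      intro h
      simp [h] at hij
    have hfin : {x | ∃ i j, partialProd A (s k) n i j ≠ 0 ∧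
        x = vecNorm ((partialProd A (s k) n).col j) / partialProd A (s k) n i j}.Finite :=
      (Set.finite_range fun p : Fin d × Fin d => vecNorm ((partialProd A (s k) n).col p.2) /
        partialProd A (s k) n p.1 p.2).subset (by rintro _ ⟨i, j, -, rfl⟩; exact ⟨(i, j), rfl⟩)
    have := hb k n h1 h2
    rw [bigLambda, if_neg hne] at this
    exact (div_le_iff₀ ((nn i j).lt_of_ne' hij)).1
      ((le_csSup hfin.bddAbove ⟨i, j, hij, rfl⟩).trans this)
  · have hfin : {x | ∃ i j j', partialProd A (s k) n i j ≠ 0 ∧ partialProd A (s k) n i j' = 0 ∧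
        x = vecNorm ((partialProd A (s k) n).col j') / partialProd A (s k) n i j}.Finite :=
      (Set.finite_range fun p : Fin d × Fin d × Fin d =>
        vecNorm ((partialProd A (s k) n).col p.2.2) / partialProd A (s k) n p.1 p.2.1).subset
        (by rintro _ ⟨i, j, j', -, -, rfl⟩; exact ⟨(i, j, j'), rfl⟩)
    exact (div_le_iff₀ ((nn i j).lt_of_ne' hij)).1
      ((le_csSup hfin.bddAbove ⟨i, j, j', hij, hij', rfl⟩).trans (hl' k n h1 h2))

/-- Under Condition `(C)`, `Λ` is bounded on all the products that start at some `s i`, and `λ` is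
exponentially small in the number of blocks. The bound `b / (1 - l)` on `Λ` is preserved by
`Λ (M N) ≤ Λ M + λ M Λ N` because `b + l * (b / (1 - l)) = b / (1 - l)`. -/
lemma CondC.exists_isNested {A : ℕ → Matrix (Fin d) (Fin d) ℝ} {s : ℕ → ℕ}
    (hA : ∀ n, 1 ≤ n → ∀ i j, 0 ≤ A n i j) (hC : CondC A s) :
    ∃ b l : ℝ, 1 ≤ b ∧ 0 ≤ l ∧ l < 1 ∧ ∀ p i n, s (i + p + 1) ≤ n →
      IsNested b (l ^ (p + 1)) (partialProd A (s i) n) := by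
  obtain ⟨b, l, hb, hl0, hl1, H⟩ := hC.exists_isNested_block hA
  have hl' : 0 < 1 - l := sub_pos.2 hl1
  have hbb : b ≤ b / (1 - l) := by
    rw [le_div_iff₀ hl']
    nlinarith
  have exact_blocks : ∀ p i n, s (i + p + 1) ≤ n → n < s (i + p + 2) →
      IsNested (b / (1 - l)) (l ^ (p + 1)) (partialProd A (s i) n) := by
    intro p
    induction p with
    | zero =>
      intro i n h1 h2
      exact (H i n h1 h2).mono hbb (by simp)
    | succ p ih =>
      intro i n h1 h2
      have e : s (i + 1) ≤ n := (hC.strictMono.monotone (by omega)).trans h1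
      have h3 := (H i (s (i + 1)) le_rfl (hC.strictMono (by omega))).mul
        (ih (i + 1) n (by convert h1 using 2; omega) (by convert h2 using 2; omega)) hl0
        (by positivity)
      rw [← partialProd_mul A (hC.strictMono i.lt_succ_self).le e] at h3
      refine h3.mono (le_of_eq ?_) (le_of_eq ?_)
      · field_simp
        ring
      · ring
  refine ⟨b / (1 - l), l, hb.trans hbb, hl0, hl1, fun p i n h => ?_⟩
  -- `q` is the number of complete blocks between `s i` and `n`, minus one.
  obtain ⟨q, hq1, hq2⟩ : ∃ q, s (i + q + 1) ≤ n ∧ n < s (i + q + 2) := by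
    have hex : ∃ q, n < s (i + q + 2) :=
      ⟨n, (show n < i + n + 2 by omega).trans_le hC.strictMono.le_apply⟩
    refine ⟨Nat.find hex, ?_, Nat.find_spec hex⟩
    rcases h0 : Nat.find hex with _ | q
    · exact (hC.strictMono.monotone (by omega)).trans h
    · exact not_lt.1 (Nat.find_min hex (m := q) (by omega))
  have hpq : p ≤ q := by
    by_contra hlt
    have := hC.strictMono.monotone (show i + q + 2 ≤ i + p + 1 by omega)
    omega
  exact (exact_blocks q i n hq1 hq2).mono le_rfl (pow_le_pow_of_le_one hl0 hl1.le (by omega))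

/-! ### Comparison of the columns of two products -/

/-- Applying the contraction property once per block, from the index `s i` down to the first one:
two vectors whose ratios lie in `[m, M]` are mapped by `A 1 ⋯ A (s i)` to vectors whose ratios lie
in an interval shorter by an exponential factor in `i`. -/
lemma exists_between_prodTo {A : ℕ → Matrix (Fin d) (Fin d) ℝ} {s : ℕ → ℕ} {b l : ℝ}
    (hA : ∀ n, 1 ≤ n → ∀ i j, 0 ≤ A n i j) (hs : StrictMono s) (hb : 1 ≤ b) (hl1 : l < 1)
    (H : ∀ i n, s (i + 1) ≤ n → IsNested b l (partialProd A (s i) n)) (j j' : Fin d) {n n' : ℕ}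
    (i : ℕ) (hn : s (i + 1) ≤ n) (hn' : s (i + 1) ≤ n') {m M : ℝ} (hmM : m ≤ M)
    (h1 : ∀ k, m * (partialProd A (s i) n').col j' k ≤ (partialProd A (s i) n).col j k)
    (h2 : ∀ k, (partialProd A (s i) n).col j k ≤ M * (partialProd A (s i) n').col j' k) :
    ∃ m' M', m ≤ m' ∧ m' ≤ M' ∧ M' ≤ M ∧ M' - m' ≤ (1 - 1 / (2 * b ^ 2)) ^ i * (M - m) ∧
      (∀ k, m' * (prodTo A n').col j' k ≤ (prodTo A n).col j k) ∧
      ∀ k, (prodTo A n).col j k ≤ M' * (prodTo A n').col j' k := by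
  induction i generalizing m M with
  | zero =>
    have e : ∀ n, s (0 + 1) ≤ n → s 0 ≤ n := fun n hn => (hs.monotone (Nat.zero_le _)).trans hn
    have nn := partialProd_nonneg hA 0 (s 0)
    have g1 := mulVec_mono nn (v := m • (partialProd A (s 0) n').col j') h1
    have g2 := mulVec_mono nn (w := M • (partialProd A (s 0) n').col j') h2
    simp only [Matrix.mulVec_smul, Pi.smul_apply, smul_eq_mul, ← col_mul,
      ← partialProd_mul A (Nat.zero_le _) (e n hn),
      ← partialProd_mul A (Nat.zero_le _) (e n' hn')] at g1 g2
    exact ⟨m, M, le_rfl, hmM, le_rfl, by simp, g1, g2⟩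
  | succ i ih =>
    have e : ∀ n, s (i + 1 + 1) ≤ n → s (i + 1) ≤ n := fun n hn =>
      (hs.monotone (by omega)).trans hn
    obtain ⟨m₁, M₁, a1, a2, a3, a4, a5, a6⟩ := (H i (s (i + 1)) le_rfl).contraction hb hl1
      (y := (partialProd A (s (i + 1)) n').col j') (fun k => partialProd_nonneg hA _ _ k j')
      (fun k hk => (H (i + 1) n' hn').norm_le k j' hk) hmM h1 h2
    simp only [← col_mul, ← partialProd_mul A (hs i.lt_succ_self).le (e n hn),
      ← partialProd_mul A (hs i.lt_succ_self).le (e n' hn')] at a5 a6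
    obtain ⟨m₂, M₂, c1, c2, c3, c4, c5, c6⟩ := ih (e n hn) (e n' hn') a2 a5 a6
    have hρ : 0 ≤ 1 - 1 / (2 * b ^ 2) := by
      rw [sub_nonneg, div_le_one (by positivity)]
      nlinarith
    refine ⟨m₂, M₂, a1.trans c1, c2, c3.trans a3, c4.trans ?_, c5, c6⟩
    calc (1 - 1 / (2 * b ^ 2)) ^ i * (M₁ - m₁)
        ≤ (1 - 1 / (2 * b ^ 2)) ^ i * ((1 - 1 / (2 * b ^ 2)) * (M - m)) := by gcongr
      _ = (1 - 1 / (2 * b ^ 2)) ^ (i + 1) * (M - m) := by ring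

/-- If the columns of two products agree in support from the index `s i` on, then the corresponding
columns of the products started at `1` are almost proportional. -/
lemma normalized_col_le {A : ℕ → Matrix (Fin d) (Fin d) ℝ} {s : ℕ → ℕ} {b l : ℝ}
    (hA : ∀ n, 1 ≤ n → ∀ i j, 0 ≤ A n i j) (hs : StrictMono s) (hb : 1 ≤ b) (hl1 : l < 1)
    (H : ∀ i n, s (i + 1) ≤ n → IsNested b l (partialProd A (s i) n)) {j j' : Fin d} {n n' : ℕ}
    {i : ℕ} (hn : s (i + 1) ≤ n) (hn' : s (i + 1) ≤ n')
    (hsupp : supp ((partialProd A (s i) n).col j) = supp ((partialProd A (s i) n').col j'))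
    (hj : (prodTo A n).col j ≠ 0) (hj' : (prodTo A n').col j' ≠ 0) (k : Fin d) :
    normalized ((prodTo A n).col j) k ≤
        (1 + b ^ 2 * (1 - 1 / (2 * b ^ 2)) ^ i) * normalized ((prodTo A n').col j') k ∧
      normalized ((prodTo A n').col j') k ≤
        (1 + b ^ 2 * (1 - 1 / (2 * b ^ 2)) ^ i) * normalized ((prodTo A n).col j) k := by
  have e : ∀ n, s (i + 1) ≤ n → s i ≤ n := fun n hn => (hs.monotone (by omega)).trans hn
  set x := (partialProd A (s i) n).col j with hx
  set y := (partialProd A (s i) n').col j' with hy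
  have hx0 : x ≠ 0 := by
    rw [prodTo_eq_mul A (e n hn), col_mul] at hj
    exact supp_nonempty.1 (supp_mulVec_nonempty hj)
  have hy0 : y ≠ 0 := by
    rw [prodTo_eq_mul A (e n' hn'), col_mul] at hj'
    exact supp_nonempty.1 (supp_mulVec_nonempty hj')
  have px := vecNorm_pos hx0
  have py := vecNorm_pos hy0
  have hb0 : 0 < b := by linarith
  have hxk : ∀ k, 0 ≤ x k := fun k => partialProd_nonneg hA _ _ k j
  have hyk : ∀ k, 0 ≤ y k := fun k => partialProd_nonneg hA _ _ k j'
  have hxb : ∀ k, x k ≠ 0 → vecNorm x ≤ b * x k := fun k hk => (H i n hn).norm_le k j hk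
  have hyb : ∀ k, y k ≠ 0 → vecNorm y ≤ b * y k := fun k hk => (H i n' hn').norm_le k j' hk
  have hiff : ∀ k, x k ≠ 0 ↔ y k ≠ 0 := fun k => Set.ext_iff.1 hsupp k
  -- The nonnull entries of `x` lie between `‖x‖ / b` and `‖x‖`, and similarly for `y`; hence their
  -- ratios lie between `m` and `b ^ 2 * m`.
  set m := vecNorm x / (b * vecNorm y) with hm
  have hm0 : 0 < m := by positivity
  have hM : b ^ 2 * m = b * vecNorm x / vecNorm y := by
    rw [hm]
    field_simp
  obtain ⟨m', M', h1, h2, -, h4, h5, h6⟩ := exists_between_prodTo hA hs hb hl1 H j j' i hn hn'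
    (m := m) (M := b ^ 2 * m) (le_mul_of_one_le_left hm0.le (one_le_pow₀ hb))
    (fun k => by
      by_cases h : y k = 0
      · rw [← hx, ← hy, h, mul_zero]
        exact hxk k
      · have h' := hxb k ((hiff k).2 h)
        rw [← hx, ← hy, hm, div_mul_eq_mul_div, div_le_iff₀ (by positivity)]
        calc vecNorm x * y k ≤ (b * x k) * vecNorm y :=
              mul_le_mul h' (le_vecNorm y k) (hyk k) ((vecNorm_nonneg x).trans h')
          _ = x k * (b * vecNorm y) := by ring)
    (fun k => by
      by_cases h : y k = 0
      · have h' : x k = 0 := by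
          by_contra h'
          exact (hiff k).1 h' h
        rw [← hx, ← hy, h, h', mul_zero]
      · have h' := hyb k h
        rw [← hx, ← hy, hM, div_mul_eq_mul_div, le_div_iff₀ py]
        calc x k * vecNorm y ≤ vecNorm x * (b * y k) :=
              mul_le_mul (le_vecNorm x k) h' (vecNorm_nonneg y) (vecNorm_nonneg x)
          _ = b * vecNorm x * y k := by ring)
  refine normalized_le_of_between (col_prodTo_nonneg hA n j) (col_prodTo_nonneg hA n' j') hj hj'
    (hm0.trans_le h1) ?_ h5 h6 k
  have hρ : 0 ≤ (1 - 1 / (2 * b ^ 2)) ^ i := by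
    apply pow_nonneg
    rw [sub_nonneg, div_le_one (by positivity)]
    nlinarith
  calc M' ≤ m' + (1 - 1 / (2 * b ^ 2)) ^ i * (b ^ 2 * m - m) := by linarith
    _ ≤ m' + (1 - 1 / (2 * b ^ 2)) ^ i * (b ^ 2 * m') := by
      gcongr
      nlinarith [sq_nonneg b]
    _ = (1 + b ^ 2 * (1 - 1 / (2 * b ^ 2)) ^ i) * m' := by ring

/-- A column of a product is negligible with respect to a column whose support from the index `s i`
on is strictly larger. -/
lemma exists_vecNorm_col_le {A : ℕ → Matrix (Fin d) (Fin d) ℝ} {s : ℕ → ℕ} {b l : ℝ}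
    (hA : ∀ n, 1 ≤ n → ∀ i j, 0 ≤ A n i j) (hs : StrictMono s) (hb : 1 ≤ b) (hl0 : 0 ≤ l)
    (H : ∀ p i n, s (i + p + 1) ≤ n → IsNested b (l ^ (p + 1)) (partialProd A (s i) n)) (i : ℕ) :
    ∃ c : ℝ, 0 ≤ c ∧ ∀ p n j j', s (i + p + 1) ≤ n → (prodTo A n).col j ≠ 0 →
      supp ((partialProd A (s i) n).col j') ⊂ supp ((partialProd A (s i) n).col j) →
      vecNorm ((prodTo A n).col j') ≤ c * l ^ (p + 1) * vecNorm ((prodTo A n).col j) := by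
  set M := prodTo A (s i) with hM
  have nM : ∀ y k, 0 ≤ M y k := partialProd_nonneg hA _ _
  -- `δ` is a lower bound for the nonnull entries of `M`.
  obtain ⟨δ, hδ, hMδ⟩ : ∃ δ : ℝ, 0 < δ ∧ ∀ y k, M y k ≠ 0 → δ ≤ M y k := by
    have : ∀ᶠ δ : ℝ in 𝓝[>] 0, ∀ y k, M y k ≠ 0 → δ ≤ M y k := by
      refine eventually_all.2 fun y => eventually_all.2 fun k => ?_
      by_cases h : M y k = 0
      · simp [h]
      · filter_upwards [Ioc_mem_nhdsGT ((nM y k).lt_of_ne' h)] with δ hδ _ using hδ.2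
    exact (this.and self_mem_nhdsWithin).exists.imp fun δ h => ⟨h.2, h.1⟩
  set D := ∑ k, vecNorm (M.col k) with hD
  have hD0 : 0 ≤ D := Finset.sum_nonneg fun k _ => vecNorm_nonneg _
  refine ⟨D * b / δ, by positivity, fun p n j j' hn hj hss => ?_⟩
  have hin : s i ≤ n := (hs.monotone (by omega)).trans hn
  have hN := H p i n hn
  set N := partialProd A (s i) n
  have nN : ∀ j k, 0 ≤ N.col j k := fun j k => hN.nonneg k j
  rw [prodTo_eq_mul A hin, col_mul] at hj ⊢
  rw [col_mul]
  obtain ⟨k₀, hk₀, hk₀'⟩ := Set.exists_of_ssubset hss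
  have hNk : vecNorm (N.col j') ≤ l ^ (p + 1) * N k₀ j :=
    hN.norm_le' k₀ j j' hk₀ (not_not.1 hk₀')
  obtain ⟨y, hy⟩ := supp_nonempty.2 hj
  obtain ⟨k₁, hk₁, hyk⟩ := (mulVec_ne_zero_iff nM (nN j) y).1 hy
  have lower : δ * vecNorm (N.col j) ≤ b * vecNorm (M.mulVec (N.col j)) := by
    calc δ * vecNorm (N.col j) ≤ M y k₁ * (b * N k₁ j) :=
          mul_le_mul (hMδ y k₁ hyk) (hN.norm_le k₁ j hk₁) (vecNorm_nonneg _) (nM _ _)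
      _ = b * (M y k₁ * N.col j k₁) := by rw [Matrix.col_apply]; ring
      _ ≤ b * vecNorm (M.mulVec (N.col j)) := by
        gcongr
        exact (mul_le_mulVec nM (nN j) y k₁).trans (le_vecNorm _ y)
  calc vecNorm (M.mulVec (N.col j')) = ∑ k, vecNorm (M.col k) * N.col j' k :=
        vecNorm_mulVec nM (nN j')
    _ ≤ ∑ k, vecNorm (M.col k) * vecNorm (N.col j') := by
        refine Finset.sum_le_sum fun k _ => ?_
        exact mul_le_mul_of_nonneg_left (le_vecNorm _ k) (vecNorm_nonneg _)
    _ = D * vecNorm (N.col j') := by rw [hD, Finset.sum_mul]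
    _ ≤ D * (l ^ (p + 1) * vecNorm (N.col j)) := by
        gcongr
        exact hNk.trans (by gcongr; exact le_vecNorm (N.col j) k₀)
    _ = D * l ^ (p + 1) / δ * (δ * vecNorm (N.col j)) := by field_simp
    _ ≤ D * l ^ (p + 1) / δ * (b * vecNorm (M.mulVec (N.col j))) := by gcongr
    _ = D * b / δ * l ^ (p + 1) * vecNorm (M.mulVec (N.col j)) := by ring

/-! ### Stabilization of the supports of the columns -/

/-- The supports of the columns of `A (m + 1) ⋯ A n`, for the indices `j` such that the column of
index `j` of the whole product `A 1 ⋯ A n` is not null. -/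
def liveSupports (A : ℕ → Matrix (Fin d) (Fin d) ℝ) (m n : ℕ) : Set (Set (Fin d)) :=
  {T | ∃ j, (prodTo A n).col j ≠ 0 ∧ supp ((partialProd A m n).col j) = T}

lemma supp_col_partialProd {A : ℕ → Matrix (Fin d) (Fin d) ℝ}
    (hA : ∀ n, 1 ≤ n → ∀ i j, 0 ≤ A n i j) {m p n : ℕ} (h : m ≤ p) (h' : p ≤ n) (j : Fin d) :
    supp ((partialProd A m n).col j) =
      suppMap (partialProd A m p) (supp ((partialProd A p n).col j)) := by
  rw [partialProd_mul A h h', col_mul, supp_mulVec (partialProd_nonneg hA _ _)]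
  exact fun k => partialProd_nonneg hA _ _ k j

lemma supp_col_prodTo {A : ℕ → Matrix (Fin d) (Fin d) ℝ}
    (hA : ∀ n, 1 ≤ n → ∀ i j, 0 ≤ A n i j) {m n : ℕ} (h : m ≤ n) (j : Fin d) :
    supp ((prodTo A n).col j) =
      suppMap (prodTo A m) (supp ((partialProd A m n).col j)) :=
  supp_col_partialProd hA m.zero_le h j

/-- Whether a column of `A 1 ⋯ A n` is null only depends on the support of the column of
`A (m + 1) ⋯ A n` with the same index. -/
lemma col_prodTo_ne_zero_iff {A : ℕ → Matrix (Fin d) (Fin d) ℝ}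
    (hA : ∀ n, 1 ≤ n → ∀ i j, 0 ≤ A n i j) {m n : ℕ} (h : m ≤ n) (j : Fin d) :
    (prodTo A n).col j ≠ 0 ↔
      (suppMap (prodTo A m) (supp ((partialProd A m n).col j))).Nonempty := by
  rw [← supp_col_prodTo hA h, supp_nonempty]

lemma liveSupports_eq_image {A : ℕ → Matrix (Fin d) (Fin d) ℝ}
    (hA : ∀ n, 1 ≤ n → ∀ i j, 0 ≤ A n i j) {m p n : ℕ} (h : m ≤ p) (h' : p ≤ n) :
    liveSupports A m n = suppMap (partialProd A m p) '' liveSupports A p n := by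
  ext T
  constructor
  · rintro ⟨j, hj, rfl⟩
    exact ⟨_, ⟨j, hj, rfl⟩, (supp_col_partialProd hA h h' j).symm⟩
  · rintro ⟨_, ⟨j, hj, rfl⟩, rfl⟩
    exact ⟨j, hj, supp_col_partialProd hA h h' j⟩

lemma liveSupports_succ_subset {A : ℕ → Matrix (Fin d) (Fin d) ℝ}
    (hA : ∀ n, 1 ≤ n → ∀ i j, 0 ≤ A n i j) {m n : ℕ} (h : m ≤ n)
    (hE : CondE (partialProd A m n)) : liveSupports A m (n + 1) ⊆ liveSupports A m n := by
  rintro _ ⟨j, hj, rfl⟩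
  have e : supp ((partialProd A m (n + 1)).col j) =
      suppMap (partialProd A m n) (supp ((A (n + 1)).col j)) := by
    rw [partialProd_succ A h, col_mul, supp_mulVec (partialProd_nonneg hA _ _)]
    exact fun k => hA _ (by omega) k j
  have hT : (supp ((A (n + 1)).col j)).Nonempty := by
    rw [prodTo, partialProd_succ A n.zero_le, col_mul] at hj
    exact supp_mulVec_nonempty hj
  obtain ⟨k, -, hk⟩ := hE.exists_suppMap_eq hT
  refine ⟨k, ?_, hk.symm.trans e.symm⟩
  rw [col_prodTo_ne_zero_iff hA h, ← hk, ← e]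
  exact (col_prodTo_ne_zero_iff hA (h.trans n.le_succ) j).1 hj

lemma exists_eventually_liveSupports_eq {A : ℕ → Matrix (Fin d) (Fin d) ℝ}
    (hA : ∀ n, 1 ≤ n → ∀ i j, 0 ≤ A n i j) {m p : ℕ} (h : m ≤ p)
    (hE : ∀ n, p ≤ n → CondE (partialProd A m n)) :
    ∃ S, ∀ᶠ n in atTop, liveSupports A m n = S := by
  let f : ℕ →o (Set (Set (Fin d)))ᵒᵈ :=
    ⟨fun n => OrderDual.toDual (liveSupports A m (p + n)), monotone_nat_of_le_succ fun n =>
      liveSupports_succ_subset hA (h.trans (p.le_add_right n)) (hE _ (p.le_add_right n))⟩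
  obtain ⟨N, hN⟩ := WellFoundedGT.monotone_chain_condition f
  refine ⟨liveSupports A m (p + N), ?_⟩
  filter_upwards [eventually_ge_atTop (p + N)] with n hn
  obtain ⟨c, rfl⟩ := Nat.exists_eq_add_of_le hn
  have : liveSupports A m (p + N) = liveSupports A m (p + (N + c)) := hN (N + c) (by omega)
  rw [add_assoc, this]

/-- From some index `s i₀` on, the classification of the columns by their supports does not become
finer when `i₀` is increased: the number of classes increases with `i₀` and is bounded. -/
lemma exists_stable_classes {A : ℕ → Matrix (Fin d) (Fin d) ℝ} {s : ℕ → ℕ}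
    (hA : ∀ n, 1 ≤ n → ∀ i j, 0 ≤ A n i j) (hs : StrictMono s)
    (hE : ∀ i n, s (i + 1) ≤ n → CondE (partialProd A (s i) n)) :
    ∃ i₀ S, (∀ᶠ n in atTop, liveSupports A (s i₀) n = S) ∧
      ∀ i, i₀ ≤ i → ∃ N, ∀ n n' j j', N ≤ n → N ≤ n' →
        (prodTo A n).col j ≠ 0 → (prodTo A n').col j' ≠ 0 →
        supp ((partialProd A (s i₀) n).col j) = supp ((partialProd A (s i₀) n').col j') →
        supp ((partialProd A (s i) n).col j) = supp ((partialProd A (s i) n').col j') := by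
  choose S hS using fun i =>
    exists_eventually_liveSupports_eq hA (hs i.lt_succ_self).le (hE i)
  have himage : ∀ i i', i ≤ i' → S i = suppMap (partialProd A (s i) (s i')) '' S i' := by
    intro i i' h
    obtain ⟨n, h1, h2, h3⟩ :=
      ((hS i).and ((hS i').and (eventually_ge_atTop (s i')))).exists
    rw [← h1, ← h2, liveSupports_eq_image hA (hs.monotone h) h3]
  have hbdd : BddAbove (Set.range fun i => (S i).ncard) := by
    refine ⟨(Set.univ : Set (Set (Fin d))).ncard, ?_⟩
    rintro _ ⟨i, rfl⟩
    exact Set.ncard_le_ncard (Set.subset_univ _)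
  obtain ⟨i₀, hi₀⟩ := Nat.sSup_mem (Set.range_nonempty _) hbdd
  refine ⟨i₀, S i₀, hS i₀, fun i hi => ?_⟩
  have hcard : (S i).ncard ≤ (S i₀).ncard := by
    have := le_csSup hbdd ⟨i, rfl⟩
    rw [← hi₀] at this
    exact this
  have hinj : Set.InjOn (suppMap (partialProd A (s i₀) (s i))) (S i) := by
    refine Set.injOn_of_ncard_image_eq (le_antisymm Set.ncard_image_le ?_)
    rwa [← himage i₀ i hi]
  obtain ⟨N, hN⟩ := eventually_atTop.1 ((hS i).and (eventually_ge_atTop (s i)))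
  refine ⟨N, fun n n' j j' hn hn' hj hj' h => hinj ?_ ?_ ?_⟩
  · rw [← (hN n hn).1]
    exact ⟨j, hj, rfl⟩
  · rw [← (hN n' hn').1]
    exact ⟨j', hj', rfl⟩
  · rwa [← supp_col_partialProd hA (hs.monotone hi) (hN n hn).2,
      ← supp_col_partialProd hA (hs.monotone hi) (hN n' hn').2]

/-- A nonempty chain of subsets of a finite type, enumerated in decreasing order. -/
lemma exists_strictAnti_range_eq {α : Type*} [Finite α] {S : Set (Set α)} (hS : S.Nonempty)
    (hchain : ∀ T ∈ S, ∀ T' ∈ S, T ⊆ T' ∨ T' ⊆ T) :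
    ∃ (K : ℕ) (t : Fin (K + 1) → Set α), StrictAnti t ∧ Set.range t = S := by
  classical
  set F : Finset ℕ := (Set.toFinite (Set.ncard '' S)).toFinset with hF
  have hF0 : F.Nonempty := by
    rw [hF, Set.Finite.toFinset_nonempty]
    exact hS.image _
  obtain ⟨K, hK⟩ := Nat.exists_eq_succ_of_ne_zero hF0.card_pos.ne'
  have hmem : ∀ h : Fin (K + 1), ∃ T ∈ S, T.ncard = F.orderEmbOfFin hK h.rev := by
    intro h
    have hc : F.orderEmbOfFin hK h.rev ∈ Set.ncard '' S :=
      (Set.Finite.mem_toFinset _).1 (F.orderEmbOfFin_mem hK h.rev)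
    exact hc
  choose t htS ht using hmem
  refine ⟨K, t, fun h h' hlt => ?_, Set.Subset.antisymm ?_ fun T hT => ?_⟩
  · have hc : (t h').ncard < (t h).ncard := by
      rw [ht, ht]
      exact (F.orderEmbOfFin hK).strictMono (Fin.rev_lt_rev.2 hlt)
    rcases hchain _ (htS h) _ (htS h') with h1 | h1
    · exact absurd (Set.ncard_le_ncard h1) hc.not_ge
    · refine lt_of_le_of_ne h1 fun e => ?_
      rw [e] at hc
      exact lt_irrefl _ hc
  · rintro _ ⟨h, rfl⟩
    exact htS h
  · have hTF : T.ncard ∈ Set.range (F.orderEmbOfFin hK) := by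
      rw [F.range_orderEmbOfFin hK, hF]
      simpa using ⟨T, hT, rfl⟩
    obtain ⟨h, hh⟩ := hTF
    refine ⟨h.rev, ?_⟩
    have hc : (t h.rev).ncard = T.ncard := by rw [ht, Fin.rev_rev, hh]
    rcases hchain _ (htS h.rev) _ hT with h1 | h1
    · exact Set.eq_of_subset_of_ncard_le h1 hc.ge
    · exact (Set.eq_of_subset_of_ncard_le h1 hc.le).symm

/-! ### Rank one asymptotics and action on positive vectors -/

lemma abs_vecNorm_sub_le (v w : Fin d → ℝ) : |vecNorm v - vecNorm w| ≤ vecNorm (v - w) := by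
  have h1 := vecNorm_add_le (v - w) w
  have h2 := vecNorm_add_le (w - v) v
  rw [sub_add_cancel] at h1 h2
  rw [← vecNorm_neg (w - v), neg_sub] at h2
  rw [abs_le]
  constructor <;> linarith

lemma matNorm_eq_sum_col (M : Matrix (Fin d) (Fin d) ℝ) :
    matNorm M = ∑ j, vecNorm (M.col j) :=
  Finset.sum_comm

lemma vecNorm_col_le_matNorm (M : Matrix (Fin d) (Fin d) ℝ) (j : Fin d) :
    vecNorm (M.col j) ≤ matNorm M := by
  rw [matNorm_eq_sum_col]
  exact Finset.single_le_sum (f := fun j => vecNorm (M.col j)) (fun j _ => vecNorm_nonneg _)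
    (Finset.mem_univ j)

lemma matNorm_pos {M : Matrix (Fin d) (Fin d) ℝ} (h : M ≠ 0) : 0 < matNorm M := by
  obtain ⟨j, hj⟩ := exists_col_ne_zero h
  exact (vecNorm_pos hj).trans_le (vecNorm_col_le_matNorm M j)

/-- The direction of a vector close to a multiple of `C` is close to the direction of `C`. -/
lemma vecNorm_mul_normalized_sub_le {w C : Fin d → ℝ} {q : ℝ} (hC : C ≠ 0) (hq : 0 ≤ q) :
    vecNorm w * vecNorm (normalized w - normalized C) ≤ 2 * vecNorm (w - q • C) := by
  have e : vecNorm w • (normalized w - normalized C) =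
      (w - q • C) + (q * vecNorm C - vecNorm w) • normalized C := by
    rw [smul_sub, vecNorm_smul_normalized, sub_smul, mul_smul, vecNorm_smul_normalized]
    abel
  have h1 : |q * vecNorm C - vecNorm w| ≤ vecNorm (w - q • C) := by
    have := abs_vecNorm_sub_le w (q • C)
    rwa [vecNorm_smul, abs_of_nonneg hq, abs_sub_comm] at this
  calc vecNorm w * vecNorm (normalized w - normalized C)
      = vecNorm (vecNorm w • (normalized w - normalized C)) := by
        rw [vecNorm_smul, abs_of_nonneg (vecNorm_nonneg w)]
    _ ≤ vecNorm (w - q • C) + |q * vecNorm C - vecNorm w| * vecNorm (normalized C) := by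
        rw [e, ← vecNorm_smul]
        exact vecNorm_add_le _ _
    _ = vecNorm (w - q • C) + |q * vecNorm C - vecNorm w| := by
        rw [vecNorm_normalized hC, mul_one]
    _ ≤ 2 * vecNorm (w - q • C) := by linarith

/-- If the normalized matrices `M n` are asymptotic to the rank one matrices `C L n`, then the
directions of the vectors `M n V`, for positive `V`, converge to the direction of `C`. -/
theorem tendsto_normalized_mulVec_of_rankOne {M : ℕ → Matrix (Fin d) (Fin d) ℝ} {C : Fin d → ℝ}
    {L : ℕ → Fin d → ℝ} (hM : ∀ n i j, 0 ≤ M n i j) (hM0 : ∀ᶠ n in atTop, M n ≠ 0)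
    (hL : ∀ n j, 0 ≤ L n j)
    (hlim : Tendsto (fun n => (matNorm (M n))⁻¹ • M n - Matrix.vecMulVec C (L n)) atTop (𝓝 0)) :
    C ≠ 0 ∧ ∀ V : Fin d → ℝ, (∀ i, 0 < V i) →
      Tendsto (fun n => normalized ((M n).mulVec V)) atTop (𝓝 (normalized C)) := by
  -- `‖M n‖⁻¹ • M n V - (L n ⬝ᵥ V) • C` tends to zero.
  have key : ∀ V : Fin d → ℝ, Tendsto (fun n => vecNorm ((matNorm (M n))⁻¹ • (M n).mulVec V -
      (L n ⬝ᵥ V) • C)) atTop (𝓝 0) := by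
    intro V
    have h1 : Tendsto (fun n => ((matNorm (M n))⁻¹ • M n - Matrix.vecMulVec C (L n)).mulVec V)
        atTop (𝓝 ((0 : Matrix (Fin d) (Fin d) ℝ).mulVec V)) :=
      ((continuous_id.matrix_mulVec continuous_const).tendsto _).comp hlim
    have h2 := (continuous_vecNorm.tendsto _).comp h1
    rw [Matrix.zero_mulVec, vecNorm_zero] at h2
    refine h2.congr fun n => ?_
    simp only [Function.comp_apply, Matrix.sub_mulVec, Matrix.smul_mulVec,
      Matrix.vecMulVec_mulVec, op_smul_eq_smul]
  have lower : ∀ V : Fin d → ℝ, (∀ i, 0 < V i) → ∃ c : ℝ, 0 < c ∧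
      ∀ᶠ n in atTop, c ≤ vecNorm ((matNorm (M n))⁻¹ • (M n).mulVec V) := by
    intro V hV
    obtain ⟨n₀, hn₀⟩ := hM0.exists
    obtain ⟨j₀, -⟩ := exists_col_ne_zero hn₀
    have : Nonempty (Fin d) := ⟨j₀⟩
    obtain ⟨k, hk⟩ := Finite.exists_min V
    refine ⟨V k, hV k, ?_⟩
    filter_upwards [hM0] with n hn
    have hp := matNorm_pos hn
    rw [vecNorm_smul, abs_of_pos (inv_pos.2 hp), inv_mul_eq_div, le_div_iff₀ hp,
      vecNorm_mulVec (hM n) (fun i => (hV i).le), matNorm_eq_sum_col, mul_comm, Finset.sum_mul]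
    exact Finset.sum_le_sum fun j _ => mul_le_mul_of_nonneg_left (hk j) (vecNorm_nonneg _)
  have hC : C ≠ 0 := by
    rintro rfl
    obtain ⟨c, hc, hlow⟩ := lower (fun _ => 1) fun _ => one_pos
    have := key fun _ => 1
    simp only [smul_zero, sub_zero] at this
    exact absurd (ge_of_tendsto this hlow) (not_le.2 hc)
  refine ⟨hC, fun V hV => ?_⟩
  obtain ⟨c, hc, hlow⟩ := lower V hV
  refine tendsto_of_vecNorm_sub ?_
  have h0 := (key V).const_mul (2 / c)
  rw [mul_zero] at h0
  refine squeeze_zero' (Eventually.of_forall fun n => vecNorm_nonneg _) ?_ h0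
  filter_upwards [hM0, hlow] with n hn hln
  have hp := inv_pos.2 (matNorm_pos hn)
  have hq : 0 ≤ L n ⬝ᵥ V := Finset.sum_nonneg fun j _ => mul_nonneg (hL n j) (hV j).le
  have h1 := vecNorm_mul_normalized_sub_le (w := (matNorm (M n))⁻¹ • (M n).mulVec V) hC hq
  have e : normalized ((matNorm (M n))⁻¹ • (M n).mulVec V) = normalized ((M n).mulVec V) := by
    rw [normalized, vecNorm_smul, abs_of_pos hp, smul_smul, mul_inv, mul_right_comm,
      inv_mul_cancel₀ hp.ne', one_mul]
  rw [e] at h1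
  rw [div_mul_eq_mul_div, le_div_iff₀ hc]
  calc vecNorm (normalized ((M n).mulVec V) - normalized C) * c
      ≤ vecNorm (normalized ((M n).mulVec V) - normalized C) *
        vecNorm ((matNorm (M n))⁻¹ • (M n).mulVec V) :=
        mul_le_mul_of_nonneg_left hln (vecNorm_nonneg _)
    _ ≤ _ := by rw [mul_comm]; exact h1

/-! ### Dominant columns -/

/-- If the columns of `M` with index in `s` have almost the direction `v`, and the other ones are
negligible, then the image of a positive vector by `M` has almost the direction `v`. -/
lemma vecNorm_normalized_mulVec_sub_le {M : Matrix (Fin d) (Fin d) ℝ} (hM : ∀ i j, 0 ≤ M i j)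
    {v W : Fin d → ℝ} {s : Finset (Fin d)} {g : Fin d} {e c : ℝ} (hv : vecNorm v = 1)
    (he : 0 ≤ e) (hg : M.col g ≠ 0)
    (h1 : ∀ j ∈ s, vecNorm (normalized (M.col j) - v) ≤ e)
    (h2 : ∀ j ∉ s, vecNorm (M.col j) ≤ e * vecNorm (M.col g)) (hc : 0 < c) (hW : ∀ i, c ≤ W i) :
    c * vecNorm (normalized (M.mulVec W) - v) ≤ e * (c + 2 * vecNorm W) := by
  have hW0 : ∀ i, 0 ≤ W i := fun i => hc.le.trans (hW i)
  have pg := vecNorm_pos hg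
  set a : Fin d → ℝ := fun j => vecNorm (M.col j) * W j with ha
  have ha0 : ∀ j, 0 ≤ a j := fun j => mul_nonneg (vecNorm_nonneg _) (hW0 j)
  set S := vecNorm (M.mulVec W) with hS
  have hSa : S = ∑ j, a j := vecNorm_mulVec hM hW0
  have hSg : c * vecNorm (M.col g) ≤ S := by
    calc c * vecNorm (M.col g) ≤ a g := by
          rw [mul_comm]
          exact mul_le_mul_of_nonneg_left (hW g) pg.le
      _ ≤ S := by
          rw [hSa]
          exact Finset.single_le_sum (fun j _ => ha0 j) (Finset.mem_univ g)
  have hS0 : 0 < S := (mul_pos hc pg).trans_le hSg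
  have e1 : S • (normalized (M.mulVec W) - v) = ∑ j, a j • (normalized (M.col j) - v) := by
    simp only [smul_sub, Finset.sum_sub_distrib]
    rw [hS, vecNorm_smul_normalized, ← hS, ← Finset.sum_smul, ← hSa]
    congr 1
    ext i
    rw [mulVec_apply_sum, Finset.sum_apply]
    refine Finset.sum_congr rfl fun j _ => ?_
    have := congrFun (vecNorm_smul_normalized (M.col j)) i
    simp only [Pi.smul_apply, smul_eq_mul, Matrix.col_apply, ha] at this ⊢
    rw [mul_right_comm, this]
  have e2 : S * vecNorm (normalized (M.mulVec W) - v) ≤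
      ∑ j, a j * vecNorm (normalized (M.col j) - v) := by
    calc S * vecNorm (normalized (M.mulVec W) - v)
        = vecNorm (S • (normalized (M.mulVec W) - v)) := by rw [vecNorm_smul, abs_of_pos hS0]
      _ ≤ ∑ j, vecNorm (a j • (normalized (M.col j) - v)) := by
          rw [e1]
          exact vecNorm_sum_le _ _
      _ = _ := Finset.sum_congr rfl fun j _ => by rw [vecNorm_smul, abs_of_nonneg (ha0 j)]
  have e3 : c * ∑ j, a j * vecNorm (normalized (M.col j) - v) ≤
      S * (e * (c + 2 * vecNorm W)) := by
    calc c * ∑ j, a j * vecNorm (normalized (M.col j) - v)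
        ≤ ∑ j, (e * c * a j + 2 * e * S * W j) := by
          rw [Finset.mul_sum]
          refine Finset.sum_le_sum fun j _ => ?_
          have p1 : 0 ≤ e * c * a j := mul_nonneg (mul_nonneg he hc.le) (ha0 j)
          have p2 : 0 ≤ 2 * e * S * W j := mul_nonneg (by positivity) (hW0 j)
          by_cases hj : j ∈ s
          · have := mul_le_mul_of_nonneg_left (h1 j hj) (mul_nonneg hc.le (ha0 j))
            linarith
          · have q1 : vecNorm (normalized (M.col j) - v) ≤ 2 := by
              have := vecNorm_sub_le (normalized (M.col j)) v
              have := vecNorm_normalized_le (M.col j)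
              linarith
            have q2 : c * a j ≤ e * S * W j := by
              calc c * a j ≤ c * (e * vecNorm (M.col g) * W j) := by
                    gcongr
                    exact mul_le_mul_of_nonneg_right (h2 j hj) (hW0 j)
                _ = e * (c * vecNorm (M.col g)) * W j := by ring
                _ ≤ e * S * W j := by
                    gcongr
                    exact hW0 j
            have q3 := mul_le_mul_of_nonneg_left q1 (mul_nonneg hc.le (ha0 j))
            linarith
      _ = S * (e * (c + 2 * vecNorm W)) := by
          rw [Finset.sum_add_distrib, ← Finset.mul_sum, ← Finset.mul_sum, ← hSa,
            vecNorm_of_nonneg hW0]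
          ring
  refine le_of_mul_le_mul_left ?_ hS0
  calc S * (c * vecNorm (normalized (M.mulVec W) - v))
      = c * (S * vecNorm (normalized (M.mulVec W) - v)) := by ring
    _ ≤ _ := (mul_le_mul_of_nonneg_left e2 hc.le).trans e3

lemma col_ne_zero_of_matSupp_eq {M : Matrix (Fin d) (Fin d) ℝ} {ι : Type*}
    {J : ι → Finset (Fin d)} {I : ι → Set (Fin d)} (hI : ∀ h, (I h).Nonempty)
    (hM : matSupp M = ⋃ h, I h ×ˢ (J h : Set (Fin d))) {h : ι} {j : Fin d} (hj : j ∈ J h) :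
    M.col j ≠ 0 := by
  obtain ⟨y, hy⟩ := hI h
  have : (y, j) ∈ matSupp M := by
    rw [hM]
    exact Set.mem_iUnion.2 ⟨h, hy, hj⟩
  exact fun h0 => this (congrFun h0 y)

/-- The limits along all sequences of indices in the classes `J h n`, combined into one error
sequence: the columns of the first class are within `e n` of `V 0`, and the columns of the other
classes are negligible with respect to a column of the first class. -/
lemma exists_error_sequence {A : ℕ → Matrix (Fin d) (Fin d) ℝ} {K : ℕ}
    {J : Fin (K + 1) → ℕ → Finset (Fin d)} {I : Fin (K + 1) → Set (Fin d)}
    {V : Fin (K + 1) → Fin d → ℝ} (hJ : ∀ h n, 1 ≤ n → (J h n).Nonempty)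
    (hI : ∀ h, (I h).Nonempty)
    (hpart : ∀ᶠ n in atTop, matSupp (prodTo A n) = ⋃ h, I h ×ˢ (J h n : Set (Fin d)))
    (hcol : ∀ h (j : ℕ → Fin d), (∀ n, 1 ≤ n → j n ∈ J h n) →
      Tendsto (fun n => normalized ((prodTo A n).col (j n))) atTop (𝓝 (V h)))
    (hratio : ∀ (h : Fin K) (j j' : ℕ → Fin d),
      (∀ n, 1 ≤ n → j n ∈ J h.castSucc n) → (∀ n, 1 ≤ n → j' n ∈ J h.succ n) →
      Tendsto (fun n => vecNorm ((prodTo A n).col (j' n)) / vecNorm ((prodTo A n).col (j n)))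
        atTop (𝓝 0)) :
    vecNorm (V 0) = 1 ∧ ∃ (g : ℕ → Fin d) (e : ℕ → ℝ), (∀ n, 0 ≤ e n) ∧ Tendsto e atTop (𝓝 0) ∧
      ∀ᶠ n in atTop, (prodTo A n).col (g n) ≠ 0 ∧
        (∀ j ∈ J 0 n, vecNorm (normalized ((prodTo A n).col j) - V 0) ≤ e n) ∧
        ∀ j ∉ J 0 n, vecNorm ((prodTo A n).col j) ≤ e n * vecNorm ((prodTo A n).col (g n)) := by
  classical
  have hex : ∀ h n, ∃ j, 1 ≤ n → j ∈ J h n := fun h n => by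
    by_cases hn : 1 ≤ n
    · exact (hJ h n hn).imp fun j hj _ => hj
    · exact ⟨(hJ h 1 le_rfl).choose, fun h' => absurd h' hn⟩
  choose g hg using hex
  have hne : ∀ᶠ n in atTop, ∀ h, ∀ j ∈ J h n, (prodTo A n).col j ≠ 0 := by
    filter_upwards [hpart] with n hn h j hj
    exact col_ne_zero_of_matSupp_eq hI hn hj
  have hV : vecNorm (V 0) = 1 := by
    have h1 := (continuous_vecNorm.tendsto _).comp (hcol 0 (g 0) fun n => hg 0 n)
    refine tendsto_nhds_unique h1 (tendsto_const_nhds.congr' ?_)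
    filter_upwards [hne, eventually_ge_atTop 1] with n hn h1n
    exact (vecNorm_normalized (hn 0 _ (hg 0 n h1n))).symm
  have hchain : ∀ h : Fin (K + 1), h ≠ 0 → ∀ j : ℕ → Fin d, (∀ n, 1 ≤ n → j n ∈ J h n) →
      Tendsto (fun n => vecNorm ((prodTo A n).col (j n)) / vecNorm ((prodTo A n).col (g 0 n)))
        atTop (𝓝 0) := by
    intro h
    induction h using Fin.induction with
    | zero => exact fun h => absurd rfl h
    | succ h ih =>
      intro _ j hj
      by_cases h0 : h.castSucc = 0
      · exact hratio h (g 0) j (fun n hn => by rw [h0]; exact hg 0 n hn) hj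
      · have h1 := hratio h (g h.castSucc) j (fun n => hg _ n) hj
        have h2 := h1.mul (ih h0 (g h.castSucc) fun n => hg _ n)
        rw [mul_zero] at h2
        refine h2.congr' ?_
        filter_upwards [hne, eventually_ge_atTop 1] with n hn h1n
        exact div_mul_div_cancel₀ (vecNorm_pos (hn _ _ (hg h.castSucc n h1n))).ne'
  -- `σ j h` is a sequence of indices in the classes `J h n`, equal to `j` whenever possible.
  set σ : Fin d → Fin (K + 1) → ℕ → Fin d := fun j h n => if j ∈ J h n then j else g h n with hσ
  have hσJ : ∀ j h n, 1 ≤ n → σ j h n ∈ J h n := by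
    intro j h n hn
    simp only [hσ]
    split_ifs with hj
    · exact hj
    · exact hg h n hn
  have hσj : ∀ j h n, j ∈ J h n → σ j h n = j := fun j h n hj => if_pos hj
  set e₁ : ℕ → ℝ := fun n => ∑ j, vecNorm (normalized ((prodTo A n).col (σ j 0 n)) - V 0)
  set e₂ : ℕ → ℝ := fun n => ∑ j, ∑ h : Fin K,
    vecNorm ((prodTo A n).col (σ j h.succ n)) / vecNorm ((prodTo A n).col (g 0 n))
  have he₁ : ∀ n, 0 ≤ e₁ n := fun n => Finset.sum_nonneg fun j _ => vecNorm_nonneg _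
  have he₂ : ∀ n, 0 ≤ e₂ n := fun n => Finset.sum_nonneg fun j _ => Finset.sum_nonneg fun h _ =>
    div_nonneg (vecNorm_nonneg _) (vecNorm_nonneg _)
  refine ⟨hV, g 0, fun n => e₁ n + e₂ n, fun n => add_nonneg (he₁ n) (he₂ n), ?_, ?_⟩
  · have t1 : Tendsto e₁ atTop (𝓝 (∑ _j : Fin d, 0)) := tendsto_finsetSum _ fun j _ =>
      tendsto_vecNorm_sub (hcol 0 (σ j 0) (hσJ j 0))
    have t2 : Tendsto e₂ atTop (𝓝 (∑ _j : Fin d, ∑ _h : Fin K, 0)) :=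
      tendsto_finsetSum _ fun j _ => tendsto_finsetSum _ fun h _ =>
        hchain h.succ (Fin.succ_ne_zero h) (σ j h.succ) (hσJ j h.succ)
    simpa using t1.add t2
  · filter_upwards [hne, hpart, eventually_ge_atTop 1] with n hn hp h1n
    have hg0 := hn 0 _ (hg 0 n h1n)
    refine ⟨hg0, fun j hj => ?_, fun j hj => ?_⟩
    · have h1 := Finset.single_le_sum
        (f := fun j => vecNorm (normalized ((prodTo A n).col (σ j 0 n)) - V 0))
        (fun j _ => vecNorm_nonneg _) (Finset.mem_univ j)
      simp only [hσj j 0 n hj] at h1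
      exact h1.trans (le_add_of_nonneg_right (he₂ n))
    · by_cases h0 : (prodTo A n).col j = 0
      · rw [h0, vecNorm_zero]
        exact mul_nonneg (add_nonneg (he₁ n) (he₂ n)) (vecNorm_nonneg _)
      obtain ⟨y, hy⟩ := supp_nonempty.2 h0
      have hyj : (y, j) ∈ matSupp (prodTo A n) := hy
      rw [hp] at hyj
      obtain ⟨h, -, hjh⟩ := Set.mem_iUnion.1 hyj
      have hh0 : h ≠ 0 := by
        rintro rfl
        exact hj hjh
      obtain ⟨h, rfl⟩ := Fin.exists_succ_eq.2 hh0
      have h1 : vecNorm ((prodTo A n).col j) / vecNorm ((prodTo A n).col (g 0 n)) ≤ e₂ n := by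
        refine le_trans ?_ (Finset.single_le_sum (f := fun j => ∑ h : Fin K,
          vecNorm ((prodTo A n).col (σ j h.succ n)) / vecNorm ((prodTo A n).col (g 0 n)))
          (fun j _ => Finset.sum_nonneg fun h _ =>
            div_nonneg (vecNorm_nonneg _) (vecNorm_nonneg _)) (Finset.mem_univ j))
        refine le_trans (le_of_eq ?_) (Finset.single_le_sum (f := fun h : Fin K =>
          vecNorm ((prodTo A n).col (σ j h.succ n)) / vecNorm ((prodTo A n).col (g 0 n)))
          (fun h _ => div_nonneg (vecNorm_nonneg _) (vecNorm_nonneg _)) (Finset.mem_univ h))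
        simp only [hσj j h.succ n hjh]
      rw [div_le_iff₀ (vecNorm_pos hg0)] at h1
      exact h1.trans (mul_le_mul_of_nonneg_right (le_add_of_nonneg_left (he₁ n))
        (vecNorm_nonneg _))

/-- In the definition of a column family, the properties `uniform` and `positive` follow from the
other ones. -/
lemma IsColumnFamily.of_columns {A : ℕ → Matrix (Fin d) (Fin d) ℝ}
    (hA : ∀ n, 1 ≤ n → ∀ i j, 0 ≤ A n i j) {K : ℕ}
    {J : Fin (K + 1) → ℕ → Finset (Fin d)} {I : Fin (K + 1) → Set (Fin d)}
    {V : Fin (K + 1) → Fin d → ℝ} (hJ : ∀ h n, 1 ≤ n → (J h n).Nonempty)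
    (hdisj : ∀ n, 1 ≤ n → ∀ h h', h ≠ h' → Disjoint (J h n) (J h' n))
    (hI : ∀ h, (I h).Nonempty) (hanti : ∀ h h', h ≤ h' → I h' ⊆ I h)
    (hpart : ∀ᶠ n in atTop, matSupp (prodTo A n) = ⋃ h, I h ×ˢ (J h n : Set (Fin d)))
    (hsupp : ∀ h, supp (V h) = I h)
    (hcol : ∀ h (j : ℕ → Fin d), (∀ n, 1 ≤ n → j n ∈ J h n) →
      Tendsto (fun n => normalized ((prodTo A n).col (j n))) atTop (𝓝 (V h)))
    (hratio : ∀ (h : Fin K) (j j' : ℕ → Fin d),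
      (∀ n, 1 ≤ n → j n ∈ J h.castSucc n) → (∀ n, 1 ≤ n → j' n ∈ J h.succ n) →
      Tendsto (fun n => vecNorm ((prodTo A n).col (j' n)) / vecNorm ((prodTo A n).col (j n)))
        atTop (𝓝 0)) :
    IsColumnFamily A K J I V := by
  obtain ⟨hV, g, e, he0, he, hev⟩ := exists_error_sequence hJ hI hpart hcol hratio
  obtain ⟨j₀, -⟩ := hJ 0 1 le_rfl
  have : Nonempty (Fin d) := ⟨j₀⟩
  have nn : ∀ n i j, 0 ≤ prodTo A n i j := fun n => partialProd_nonneg hA 0 n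
  refine ⟨hJ, hdisj, hI, hanti, hpart, hsupp, hcol, hratio, ?_, fun W hW => ⟨?_, ?_⟩⟩
  · obtain ⟨N, hN⟩ := eventually_atTop.1 hev
    -- For `n < N` the trivial bound `2` is used; the term `1 / (n + 1)` makes `ε n` positive.
    refine ⟨fun n => if N ≤ n then 3 * e n + 1 / (n + 1 : ℝ) else 2, fun n => ?_, ?_, ?_⟩
    · dsimp only
      split_ifs
      · have := he0 n
        positivity
      · norm_num
    · have t : Tendsto (fun n : ℕ => 3 * e n + 1 / (n + 1 : ℝ)) atTop (𝓝 0) := by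
        simpa using (he.const_mul 3).add tendsto_one_div_add_atTop_nhds_zero_nat
      refine t.congr' ?_
      filter_upwards [eventually_ge_atTop N] with n hn
      rw [if_pos hn]
    · intro W hW hW1 _ n hn h hh
      beta_reduce
      have hmin0 : 0 ≤ ⨅ i, W i := Real.iInf_nonneg hW
      have hmin : ∀ i, ⨅ i, W i ≤ W i := fun i => ciInf_le (Set.finite_range W).bddBelow i
      have hmin1 : ⨅ i, W i ≤ 1 := (hmin j₀).trans ((le_vecNorm W j₀).trans hW1.le)
      rcases hmin0.eq_or_lt with h0 | h0
      · rw [← h0, zero_mul]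
        split_ifs
        · have := he0 n
          positivity
        · norm_num
      -- All the entries of `W` are positive, hence the class to be considered is the first one.
      have hh0 : h = 0 := by
        obtain ⟨j, hj⟩ := hJ 0 n hn
        exact le_antisymm (hh.2 ⟨j, (h0.trans_le (hmin j)).ne', hj⟩) (Fin.zero_le h)
      rw [hh0]
      split_ifs with hNn
      · obtain ⟨h1, h2, h3⟩ := hN n hNn
        have := vecNorm_normalized_mulVec_sub_le (nn n) hV (he0 n) h1 h2 h3 h0 hmin
        rw [hW1] at this
        have h4 : e n * ((⨅ i, W i) + 2 * 1) ≤ e n * 3 :=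
          mul_le_mul_of_nonneg_left (by linarith) (he0 n)
        have h5 : (0 : ℝ) < 1 / (n + 1 : ℝ) := by positivity
        exact (this.trans h4).trans (by linarith)
      · have h1 := vecNorm_sub_le (normalized ((prodTo A n).mulVec W)) (V 0)
        have h2 := vecNorm_normalized_le ((prodTo A n).mulVec W)
        exact (mul_le_of_le_one_left (vecNorm_nonneg _) hmin1).trans (by linarith)
  · obtain ⟨k, hk⟩ := Finite.exists_min W
    refine tendsto_of_vecNorm_sub ?_
    have t := he.mul_const ((W k + 2 * vecNorm W) / W k)
    rw [zero_mul] at t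
    refine squeeze_zero' (Eventually.of_forall fun n => vecNorm_nonneg _) ?_ t
    filter_upwards [hev] with n hn
    obtain ⟨h1, h2, h3⟩ := hn
    have := vecNorm_normalized_mulVec_sub_le (nn n) hV (he0 n) h1 h2 h3 (hW k) hk
    rw [mul_div_assoc', le_div_iff₀ (hW k), mul_comm]
    exact this
  · filter_upwards [hpart, eventually_ge_atTop 1] with n hn h1n
    rw [supp_mulVec (nn n) fun i => (hW i).le, hsupp]
    ext y
    constructor
    · rintro ⟨k, -, hk⟩
      have hyk : (y, k) ∈ matSupp (prodTo A n) := hk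
      rw [hn] at hyk
      obtain ⟨h, hy, -⟩ := Set.mem_iUnion.1 hyk
      exact hanti 0 h (Fin.zero_le h) hy
    · intro hy
      obtain ⟨j, hj⟩ := hJ 0 n h1n
      have hyj : (y, j) ∈ matSupp (prodTo A n) := by
        rw [hn]
        exact Set.mem_iUnion.2 ⟨0, hy, hj⟩
      exact ⟨j, (hW j).ne', hyj⟩

/-- A column family describes the normalized products up to a vanishing error: they are asymptotic
to rank one matrices whose columns are multiples of `V 0`. -/
theorem IsColumnFamily.tendsto_rankOne {A : ℕ → Matrix (Fin d) (Fin d) ℝ} {K : ℕ}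
    {J : Fin (K + 1) → ℕ → Finset (Fin d)} {I : Fin (K + 1) → Set (Fin d)}
    {V : Fin (K + 1) → Fin d → ℝ} (hF : IsColumnFamily A K J I V) :
    Tendsto (fun n => (matNorm (prodTo A n))⁻¹ • prodTo A n -
        Matrix.vecMulVec (normalized (V 0))
          (fun j => if j ∈ J 0 n then
            vecNorm ((prodTo A n).col j) / matNorm (prodTo A n) else 0))
      atTop (𝓝 0) := by
  obtain ⟨hV, g, e, he0, he, hev⟩ := exists_error_sequence hF.J_nonempty hF.I_nonempty
    hF.partition hF.tendsto_column hF.tendsto_ratio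
  have hV' : normalized (V 0) = V 0 := by rw [normalized, hV, inv_one, one_smul]
  rw [hV']
  refine tendsto_pi_nhds.2 fun i => tendsto_pi_nhds.2 fun j => ?_
  refine squeeze_zero_norm' ?_ he
  filter_upwards [hev] with n hn
  obtain ⟨h1, h2, h3⟩ := hn
  set P := prodTo A n
  have hp : 0 < matNorm P := (vecNorm_pos h1).trans_le (vecNorm_col_le_matNorm P (g n))
  simp only [Matrix.sub_apply, Matrix.smul_apply, Matrix.vecMulVec_apply, smul_eq_mul,
    Real.norm_eq_abs]
  by_cases hj : j ∈ J 0 n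
  · rw [if_pos hj]
    have e1 := congrFun (vecNorm_smul_normalized (P.col j)) i
    rw [Matrix.col_apply, Pi.smul_apply, smul_eq_mul] at e1
    have e2 : (matNorm P)⁻¹ * P i j - V 0 i * (vecNorm (P.col j) / matNorm P) =
        vecNorm (P.col j) / matNorm P * (normalized (P.col j) - V 0) i := by
      rw [← e1, Pi.sub_apply]
      ring
    rw [e2, abs_mul, abs_of_nonneg (div_nonneg (vecNorm_nonneg _) hp.le)]
    calc _ ≤ 1 * e n := mul_le_mul ((div_le_one hp).2 (vecNorm_col_le_matNorm P j))
          ((abs_le_vecNorm _ i).trans (h2 j hj)) (abs_nonneg _) zero_le_one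
      _ = e n := one_mul _
  · rw [if_neg hj, mul_zero, sub_zero, abs_mul, abs_of_pos (inv_pos.2 hp), inv_mul_eq_div,
      div_le_iff₀ hp]
    calc |P i j| ≤ vecNorm (P.col j) := abs_le_vecNorm (P.col j) i
      _ ≤ e n * vecNorm (P.col (g n)) := h3 j hj
      _ ≤ e n * matNorm P := mul_le_mul_of_nonneg_left (vecNorm_col_le_matNorm P _) (he0 n)

/-! ### Existence of a column family -/

/-- The columns of `A 1 ⋯ A n` are classified by the supports of the columns of
`A (s i₀ + 1) ⋯ A n`, where `i₀` is large enough for this classification to be the finest one. -/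
theorem exists_isColumnFamily {A : ℕ → Matrix (Fin d) (Fin d) ℝ} {s : ℕ → ℕ}
    (hA : ∀ n, 1 ≤ n → ∀ i j, 0 ≤ A n i j) (hC : CondC A s)
    (h0 : ¬ ∀ᶠ n in atTop, prodTo A n = 0) :
    ∃ (K : ℕ) (J : Fin (K + 1) → ℕ → Finset (Fin d)) (I : Fin (K + 1) → Set (Fin d))
      (V : Fin (K + 1) → Fin d → ℝ), IsColumnFamily A K J I V := by
  classical
  have hs := hC.strictMono
  obtain ⟨b, l, hb, hl0, hl1, H⟩ := hC.exists_isNested hA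
  have H0 : ∀ i n, s (i + 1) ≤ n → IsNested b l (partialProd A (s i) n) := fun i n hn => by
    simpa using H 0 i n hn
  obtain ⟨i₀, S, hS, hstab⟩ := exists_stable_classes hA hs fun i n hn => (H0 i n hn).condE
  obtain ⟨N, hN⟩ := eventually_atTop.1 (hS.and (eventually_ge_atTop (s (i₀ + 1))))
  have hNs : ∀ n, N ≤ n → s i₀ ≤ n := fun n hn => (hs i₀.lt_succ_self).le.trans (hN n hn).2
  have hSne : S.Nonempty := by
    obtain ⟨j, hj⟩ := exists_col_ne_zero (prodTo_ne_zero h0 N)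
    rw [← (hN N le_rfl).1]
    exact ⟨_, j, hj, rfl⟩
  have hchain : ∀ T ∈ S, ∀ T' ∈ S, T ⊆ T' ∨ T' ⊆ T := by
    rw [← (hN N le_rfl).1]
    rintro _ ⟨j, -, rfl⟩ _ ⟨j', -, rfl⟩
    exact (H0 i₀ N (hN N le_rfl).2).condE j j'
  obtain ⟨K, t, ht, hrange⟩ := exists_strictAnti_range_eq hSne hchain
  -- For the small values of `n`, for which the classification may differ, the classes are those
  -- of the index `N`.
  set J : Fin (K + 1) → ℕ → Finset (Fin d) := fun h n => Finset.univ.filter fun j =>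
    (prodTo A (max n N)).col j ≠ 0 ∧ supp ((partialProd A (s i₀) (max n N)).col j) = t h with hJdef
  have hJ : ∀ n, N ≤ n → ∀ h j, j ∈ J h n ↔
      (prodTo A n).col j ≠ 0 ∧ supp ((partialProd A (s i₀) n).col j) = t h := by
    intro n hn h j
    simp [hJdef, max_eq_left hn]
  have hJne : ∀ h n, (J h n).Nonempty := by
    intro h n
    have : t h ∈ liveSupports A (s i₀) (max n N) := by
      rw [(hN _ (le_max_right n N)).1, ← hrange]
      exact ⟨h, rfl⟩
    obtain ⟨j, hj⟩ := this
    exact ⟨j, Finset.mem_filter.2 ⟨Finset.mem_univ j, hj⟩⟩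
  choose g hg using hJne
  set I : Fin (K + 1) → Set (Fin d) := fun h => suppMap (prodTo A (s i₀)) (t h)
  have hIsupp : ∀ n, N ≤ n → ∀ h, ∀ j ∈ J h n, supp ((prodTo A n).col j) = I h := by
    intro n hn h j hj
    rw [supp_col_prodTo hA (hNs n hn), ((hJ n hn h j).1 hj).2]
  set r : ℕ → ℝ := fun i => 1 + b ^ 2 * (1 - 1 / (2 * b ^ 2)) ^ i
  have hρ0 : 0 ≤ 1 - 1 / (2 * b ^ 2) := by
    rw [sub_nonneg, div_le_one (by positivity)]
    nlinarith
  have hρ1 : 1 - 1 / (2 * b ^ 2) < 1 := sub_lt_self _ (by positivity)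
  have hr1 : ∀ i, 1 ≤ r i := fun i => le_add_of_nonneg_right (by positivity)
  have hrlim : Tendsto r atTop (𝓝 1) := by
    have := ((tendsto_pow_atTop_nhds_zero_of_lt_one hρ0 hρ1).const_mul (b ^ 2)).const_add 1
    rwa [mul_zero, add_zero] at this
  have hclose : ∀ i, i₀ ≤ i → ∃ N', N ≤ N' ∧ ∀ h n n', N' ≤ n → N' ≤ n' → ∀ j ∈ J h n,
      ∀ j' ∈ J h n', ∀ k,
      normalized ((prodTo A n).col j) k ≤ r i * normalized ((prodTo A n').col j') k ∧
      normalized ((prodTo A n').col j') k ≤ r i * normalized ((prodTo A n).col j) k := by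
    intro i hi
    obtain ⟨N', hN'⟩ := hstab i hi
    refine ⟨max N (max N' (s (i + 1))), le_max_left _ _, fun h n n' hn hn' j hj j' hj' k => ?_⟩
    simp only [max_le_iff] at hn hn'
    obtain ⟨a1, a2⟩ := (hJ n hn.1 h j).1 hj
    obtain ⟨a1', a2'⟩ := (hJ n' hn'.1 h j').1 hj'
    exact normalized_col_le hA hs hb hl1 H0 hn.2.2 hn'.2.2
      (hN' n n' j j' hn.2.1 hn'.2.1 a1 a1' (a2.trans a2'.symm)) a1 a1' k
  have hclose' : ∀ ε : ℝ, 0 < ε → ∃ N', ∀ h n n', N' ≤ n → N' ≤ n' → ∀ j ∈ J h n,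
      ∀ j' ∈ J h n',
      vecNorm (normalized ((prodTo A n).col j) - normalized ((prodTo A n').col j')) < ε := by
    intro ε hε
    obtain ⟨i, hi, hi'⟩ := ((hrlim.eventually_lt_const (show (1 : ℝ) < 1 + ε / 2 by linarith)).and
      (eventually_ge_atTop i₀)).exists
    obtain ⟨N', -, hN'⟩ := hclose i hi'
    refine ⟨N', fun h n n' hn hn' j hj j' hj' => ?_⟩
    have := vecNorm_normalized_sub_le (hr1 i) (col_prodTo_nonneg hA n j)
      (col_prodTo_nonneg hA n' j') (hN' h n n' hn hn' j hj j' hj')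
    linarith
  have hlim : ∀ h, ∃ v, Tendsto (fun n => normalized ((prodTo A n).col (g h n))) atTop (𝓝 v) := by
    intro h
    refine cauchySeq_tendsto_of_complete (Metric.cauchySeq_iff'.2 fun ε hε => ?_)
    obtain ⟨N', hN'⟩ := hclose' ε hε
    refine ⟨N', fun n hn => lt_of_le_of_lt ?_ (hN' h n N' hn le_rfl _ (hg h n) _ (hg h N'))⟩
    refine (dist_pi_le_iff (vecNorm_nonneg _)).2 fun k => ?_
    rw [Real.dist_eq]
    exact abs_le_vecNorm (normalized ((prodTo A n).col (g h n)) -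
      normalized ((prodTo A N').col (g h N'))) k
  choose V hV using hlim
  refine ⟨K, J, I, V, IsColumnFamily.of_columns hA (fun h n _ => ⟨g h n, hg h n⟩) ?_ ?_ ?_ ?_ ?_
    ?_ ?_⟩
  · intro n _ h h' hh
    refine Finset.disjoint_left.2 fun j hj hj' => hh (ht.injective ?_)
    rw [← (Finset.mem_filter.1 hj).2.2, (Finset.mem_filter.1 hj').2.2]
  · intro h
    rw [← hIsupp N le_rfl h _ (hg h N), supp_nonempty]
    exact ((hJ N le_rfl h _).1 (hg h N)).1
  · exact fun h h' hh => suppMap_mono _ (ht.antitone hh)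
  · filter_upwards [eventually_ge_atTop N] with n hn
    ext ⟨y, j⟩
    rw [Set.mem_iUnion]
    constructor
    · intro hy
      have hj : (prodTo A n).col j ≠ 0 := supp_nonempty.1 ⟨y, hy⟩
      have hT : supp ((partialProd A (s i₀) n).col j) ∈ Set.range t := by
        rw [hrange, ← (hN n hn).1]
        exact ⟨j, hj, rfl⟩
      obtain ⟨h, hh⟩ := hT
      have hjh := (hJ n hn h j).2 ⟨hj, hh.symm⟩
      refine ⟨h, ?_, hjh⟩
      rw [← hIsupp n hn h j hjh]
      exact hy
    · rintro ⟨h, hy, hj⟩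
      rw [← hIsupp n hn h j hj] at hy
      exact hy
  · intro h
    ext k
    have hVk := tendsto_pi_nhds.1 (hV h) k
    constructor
    · intro hk
      by_contra hkI
      refine hk (tendsto_nhds_unique (hVk.congr' ?_) tendsto_const_nhds)
      filter_upwards [eventually_ge_atTop N] with n hn
      rw [← hIsupp n hn h _ (hg h n)] at hkI
      have hk0 : (prodTo A n).col (g h n) k = 0 := not_not.1 hkI
      rw [normalized, Pi.smul_apply, hk0, smul_zero]
    · intro hk
      obtain ⟨N', hNN', hN'⟩ := hclose i₀ le_rfl
      have hle : normalized ((prodTo A N').col (g h N')) k ≤ r i₀ * V h k := by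
        refine ge_of_tendsto (hVk.const_mul (r i₀)) ?_
        filter_upwards [eventually_ge_atTop N'] with n hn
        exact (hN' h n N' hn le_rfl _ (hg h n) _ (hg h N') k).2
      have hpos : 0 < normalized ((prodTo A N').col (g h N')) k := by
        rw [← hIsupp N' hNN' h _ (hg h N')] at hk
        exact mul_pos (inv_pos.2 (vecNorm_pos (supp_nonempty.1 ⟨k, hk⟩)))
          ((col_prodTo_nonneg hA N' _ k).lt_of_ne' hk)
      intro hVk0
      rw [hVk0, mul_zero] at hle
      exact absurd hpos (not_lt.2 hle)
  · intro h j hj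
    have t1 : Tendsto (fun n => vecNorm (normalized ((prodTo A n).col (j n)) -
        normalized ((prodTo A n).col (g h n)))) atTop (𝓝 0) := by
      refine Metric.tendsto_atTop.2 fun ε hε => ?_
      obtain ⟨N', hN'⟩ := hclose' ε hε
      refine ⟨max N' 1, fun n hn => ?_⟩
      rw [ge_iff_le, max_le_iff] at hn
      rw [Real.dist_0_eq_abs, abs_of_nonneg (vecNorm_nonneg _)]
      exact hN' h n n hn.1 hn.1 _ (hj n hn.2) _ (hg h n)
    refine tendsto_of_vecNorm_sub (squeeze_zero (fun n => vecNorm_nonneg _) (fun n => ?_)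
      (by simpa using t1.add (tendsto_vecNorm_sub (hV h))))
    have := vecNorm_add_le (normalized ((prodTo A n).col (j n)) -
      normalized ((prodTo A n).col (g h n))) (normalized ((prodTo A n).col (g h n)) - V h)
    rwa [sub_add_sub_cancel] at this
  · intro h j j' hj hj'
    obtain ⟨c, hc0, hc⟩ := exists_vecNorm_col_le hA hs hb hl0 H i₀
    have hcl : Tendsto (fun p => c * l ^ (p + 1)) atTop (𝓝 0) := by
      have := (tendsto_pow_atTop_nhds_zero_of_lt_one hl0 hl1).comp (tendsto_add_atTop_nat 1)
      simpa using this.const_mul c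
    refine Metric.tendsto_atTop.2 fun ε hε => ?_
    obtain ⟨p, hp⟩ := (hcl.eventually_lt_const hε).exists
    refine ⟨max (max N 1) (s (i₀ + p + 1)), fun n hn => ?_⟩
    simp only [ge_iff_le, max_le_iff] at hn
    obtain ⟨⟨hn1, hn2⟩, hn3⟩ := hn
    obtain ⟨a1, a2⟩ := (hJ n hn1 _ _).1 (hj n hn2)
    obtain ⟨-, a2'⟩ := (hJ n hn1 _ _).1 (hj' n hn2)
    have := hc p n (j n) (j' n) hn3 a1 (by
      rw [a2, a2']
      exact ht h.castSucc_lt_succ)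
    rw [Real.dist_0_eq_abs, abs_of_nonneg (div_nonneg (vecNorm_nonneg _) (vecNorm_nonneg _))]
    exact ((div_le_iff₀ (vecNorm_pos a1)).2 this).trans_lt hp

end NonnegProd

theorem mainTheorem8 (d : ℕ) :
    (∀ (M : ℕ → Matrix (Fin d) (Fin d) ℝ) (C : Fin d → ℝ) (L : ℕ → Fin d → ℝ),
      (∀ n i j, 0 ≤ M n i j) → (∀ᶠ n in atTop, M n ≠ 0) →
      (∀ i, 0 ≤ C i) → (∀ n j, 0 ≤ L n j) →
      Tendsto (fun n => (matNorm (M n))⁻¹ • M n - Matrix.vecMulVec C (L n)) atTop (𝓝 0) →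
      C ≠ 0 ∧
      ∀ V : Fin d → ℝ, (∀ i, 0 < V i) →
        Tendsto (fun n => (vecNorm ((M n).mulVec V))⁻¹ • (M n).mulVec V)
          atTop (𝓝 ((vecNorm C)⁻¹ • C)))
    ∧
    (∀ (A : ℕ → Matrix (Fin d) (Fin d) ℝ) (s : ℕ → ℕ),
      (∀ n, 1 ≤ n → ∀ i j, 0 ≤ A n i j) → CondC A s →
      (¬ ∀ᶠ n in atTop, prodTo A n = 0) →
      (∃ (K : ℕ) (J : Fin (K + 1) → ℕ → Finset (Fin d)) (I : Fin (K + 1) → Set (Fin d))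
        (V : Fin (K + 1) → Fin d → ℝ), IsColumnFamily A K J I V) ∧
      ∀ (K : ℕ) (J : Fin (K + 1) → ℕ → Finset (Fin d)) (I : Fin (K + 1) → Set (Fin d))
        (V : Fin (K + 1) → Fin d → ℝ), IsColumnFamily A K J I V →
        Tendsto (fun n => (matNorm (prodTo A n))⁻¹ • prodTo A n -
            Matrix.vecMulVec ((vecNorm (V 0))⁻¹ • V 0)
              (fun j => if j ∈ J 0 n then
                vecNorm ((prodTo A n).col j) / matNorm (prodTo A n) else 0))
          atTop (𝓝 0)) :=
  ⟨fun _ _ _ hM hM0 _ hL hlim => tendsto_normalized_mulVec_of_rankOne hM hM0 hL hlim,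
    fun _ _ hA hC h0 => ⟨exists_isColumnFamily hA hC h0, fun _ _ _ _ hF => hF.tendsto_rankOne⟩⟩
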